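/- \textbf{Theorem (Duality for semistatic robust utility maximisation).} Let $N\ge 1$, let $S=(S_i)_{1\le i\le N}$ be the coordinate process on $\mathbb R^N$, let $S_0\equiv s_0\in\mathbb R$, and let $\mathcal P$ be a set of Borel probability measures on $\mathbb R^N$ which is convex and compact for the weak topology induced by $C_b(\mathbb R^N)$. Let $\mu=(\mu_i)_{1\le i\le N}$ be probability measures on $\mathbb R$ with $\int|y|\,d\mu_i<\infty$, $\int y\,d\mu_i=s_0$, and such that $i\mapsto\int f\,d\mu_i\in(-\infty,\infty]$ is increasing for every convex $f:\mathbb R\to\mathbb R$. Let $\mathcal M_\mu$ be the set of Borel probability measures $Q$ on $\mathbb R^N$ under which $(S_i)_{0\le i\le N}$ is a martingale in its own filtration and $Q\circ S_i^{-1}=\mu_i$ for $i=1,\dots,N$. Let $U:\mathbb R\to\mathbb R$ be strictly concave and differentiable with $\lim_{x\to-\infty}U'(x)=+\infty$ and $\lim_{x\to\infty}U'(x)=0$, and put $V(y)=\sup_{x\in\mathbb R}(U(x)-xy)\in(-\infty,\infty]$. For a finite positive Borel measure $\nu$ on $\mathbb R^N$ let $J_V(\nu|P)=E_P[V(d\nu/dP)]$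 if $\nu\ll P$ and $J_V(\nu|P)=+\infty$ otherwise, and let $J_{V,\mathcal P}(\nu)=\inf_{P\in\mathcal P}J_V(\nu|P)$. Assume $$\inf_{\lambda>0,\;Q\in\mathcal M_\mu}J_{V,\mathcal P}(\lambda Q)<\infty$$ and, for all $i\in\{1,\dots,N\}$ and all $\alpha>0$, $$\lim_{n\to\infty}\ \sup_{P\in\mathcal P}E_P\bigl[U(-\alpha|S_i|)^-\,\mathbf 1_{\{|S_i|>n\}}\bigr]=0 .$$ A semistatic strategy is a pair $(H,f)$ with $f=(f_i)_{i\le N}\in C_b(\mathbb R)^N$ and $H=(H_i)_{i\le N}$, where $H_1$ is constant and $H_i=h_i(S_1,\dots,S_{i-1})$ with $h_i\in C_b(\mathbb R^{i-1})$ for $i\ge2$. For $\Psi:\mathbb R^N\to\mathbb R$ and $x\in\mathbb R$ put $$u_\Psi(x)=\sup_{(H,f)}\ \inf_{P\in\mathcal P}E_P\Bigl[U\Bigl(x+\sum_{i\le N}H_i(S_i-S_{i-1})+\sum_{i\le N}\Bigl(f_i(S_i)-\int f_i\,d\mu_i\Bigr)-\Psi\Bigr)\Bigr].$$ Then for every upper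 semicontinuous $\Psi:\mathbb R^N\to\mathbb R$ with linear growth, i.e. $|\Psi(\omega)|\le c(1+|\omega_1|+\cdots+|\omega_N|)$ for some $c>0$, and every $x\in\mathbb R$, the function $\Psi$ is integrable under every $Q\in\mathcal M_\mu$, and $$u_\Psi(x)=\min_{\lambda>0,\;Q\in\mathcal M_\mu}\bigl(J_{V,\mathcal P}(\lambda Q)-\lambda E_Q[\Psi]+\lambda x\bigr),$$ the minimum being attained. -/

import Mathlib

open MeasureTheory ProbabilityTheory Filter Topology Set
open scoped ENNReal NNReal BoundedContinuousFunction

noncomputable section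

namespace Semistatic

/-- Extended expectation `E_P[f] = E_P[f⁺] - E_P[f⁻]` of an extended-real function.
It agrees with the Bochner integral on integrable real functions; `∞ - ∞` is `-∞` (`⊥`). -/
def eexp {Ω : Type*} [MeasurableSpace Ω] (P : Measure Ω) (f : Ω → EReal) : EReal :=
  ((∫⁻ ω, (f ω).toENNReal ∂P : ℝ≥0∞) : EReal) - ((∫⁻ ω, (-f ω).toENNReal ∂P : ℝ≥0∞) : EReal)

/-- The conjugate `V(y) = sup_x (U(x) - x y)`, with values in `(-∞, +∞]`. -/
def conj (U : ℝ → ℝ) (y : ℝ) : EReal :=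
  ⨆ x : ℝ, ((U x - x * y : ℝ) : EReal)

open Classical in
/-- The divergence `J_V(ν | P)` of a finite positive measure `ν`:
`E_P[V(dν/dP)]` if `ν ≪ P`, and `+∞` otherwise. -/
def divergence {Ω : Type*} [MeasurableSpace Ω] (V : ℝ → EReal) (ν P : Measure Ω) : EReal :=
  if ν ≪ P then eexp P (fun ω => V (ν.rnDeriv P ω).toReal) else ⊤

/-- The robust divergence `J_{V,Pfam}(ν) = inf_{P ∈ Pfam} J_V(ν | P)`. -/
def robustDivergence {Ω : Type*} [MeasurableSpace Ω] (V : ℝ → EReal)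
    (Pfam : Set (ProbabilityMeasure Ω)) (ν : Measure Ω) : EReal :=
  ⨅ P ∈ Pfam, divergence V ν (P : Measure Ω)

/-- Convexity of a set of probability measures, as a subset of the space of measures. -/
def IsConvexFamily {Ω : Type*} [MeasurableSpace Ω] (Pfam : Set (ProbabilityMeasure Ω)) : Prop :=
  Convex ℝ≥0 ((fun P : ProbabilityMeasure Ω => (P : Measure Ω)) '' Pfam)

/-- The path space `ℝ^N`; the coordinate `ω i` (with `i = 0, …, N - 1`) is `S_{i+1}(ω)`. -/
abbrev Path (N : ℕ) : Type := Fin N → ℝ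

/-- The price process `S_0, …, S_N`: `S_0 = s₀` and `S_{i+1}(ω) = ω i`. -/
def price {N : ℕ} (s₀ : ℝ) (t : Fin (N + 1)) (ω : Path N) : ℝ :=
  (Fin.cons s₀ ω : Fin (N + 1) → ℝ) t

theorem price_measurable {N : ℕ} (s₀ : ℝ) (t : Fin (N + 1)) :
    Measurable (price (N := N) s₀ t) := by
  refine Fin.cases ?_ (fun i => ?_) t
  · exact measurable_const
  · exact measurable_pi_apply i

/-- The filtration generated by the price process. -/
def priceFiltration (N : ℕ) (s₀ : ℝ) :
    Filtration (Fin (N + 1)) (inferInstance : MeasurableSpace (Path N)) :=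
  Filtration.natural (price s₀) (fun t => (price_measurable s₀ t).stronglyMeasurable)

/-- `ℳ_μ`: probability measures on `ℝ^N` under which `S` is a martingale (with `S_0 = s₀`) and
`S_i` has law `μ_i` for every `i`. -/
def martingaleMeasures {N : ℕ} (s₀ : ℝ) (μ : Fin N → ProbabilityMeasure ℝ) :
    Set (ProbabilityMeasure (Path N)) :=
  {Q | Martingale (price s₀) (priceFiltration N s₀) (Q : Measure (Path N)) ∧
    ∀ i : Fin N, (Q : Measure (Path N)).map (fun ω => ω i) = (μ i : Measure ℝ)}

/-- Every `μ_i` is integrable with mean `s₀`, and the `μ_i` increase in convex order. -/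
structure IncreasingConvexOrder {N : ℕ} (s₀ : ℝ) (μ : Fin N → ProbabilityMeasure ℝ) :
    Prop where
  integrable : ∀ i, Integrable (fun y : ℝ => y) (μ i : Measure ℝ)
  mean_eq : ∀ i, ∫ y, y ∂(μ i : Measure ℝ) = s₀
  mono : ∀ f : ℝ → ℝ, ConvexOn ℝ univ f → ∀ i j, i ≤ j →
    eexp (μ i : Measure ℝ) (fun y => (f y : EReal)) ≤
      eexp (μ j : Measure ℝ) (fun y => (f y : EReal))

/-- Dynamic strategies: the position held over the period from `t` to `t + 1` is a bounded
continuous function of `S_1, …, S_t` (a constant for `t = 0`). -/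
abbrev DynamicStrategy (N : ℕ) : Type :=
  (t : Fin N) → ((Fin (t : ℕ) → ℝ) →ᵇ ℝ)

/-- Terminal gain `∑ₜ H_{t+1} (S_{t+1} - S_t)` of a dynamic strategy. -/
def dynamicGain {N : ℕ} (s₀ : ℝ) (H : DynamicStrategy N) (ω : Path N) : ℝ :=
  ∑ t : Fin N, H t (fun j => ω (Fin.castLE t.isLt.le j)) *
    (price s₀ t.succ ω - price s₀ t.castSucc ω)

/-- Gain `∑ᵢ (f_i(S_i) - μ_i(f_i))` of a static position in vanilla options. -/
def staticGain {N : ℕ} (μ : Fin N → ProbabilityMeasure ℝ) (f : Fin N → (ℝ →ᵇ ℝ))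
    (ω : Path N) : ℝ :=
  ∑ i : Fin N, (f i (ω i) - ∫ y, f i y ∂(μ i : Measure ℝ))

/-- The robust value `u_Ψ(x)` over semistatic strategies. -/
def robustValue {N : ℕ} (s₀ : ℝ) (μ : Fin N → ProbabilityMeasure ℝ) (U : ℝ → ℝ)
    (Pfam : Set (ProbabilityMeasure (Path N))) (Ψ : Path N → ℝ) (x : ℝ) : EReal :=
  ⨆ (H : DynamicStrategy N) (f : Fin N → (ℝ →ᵇ ℝ)), ⨅ P ∈ Pfam,
    eexp (P : Measure (Path N))
      (fun ω => ((U (x + dynamicGain s₀ H ω + staticGain μ f ω - Ψ ω) : ℝ) : EReal))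

/-- A utility function finite on `ℝ`: strictly concave, differentiable, with Inada conditions. -/
structure IsInadaUtility (U : ℝ → ℝ) : Prop where
  strictConcave : StrictConcaveOn ℝ univ U
  differentiable : Differentiable ℝ U
  deriv_atBot : Tendsto (deriv U) atBot atTop
  deriv_atTop : Tendsto (deriv U) atTop (𝓝 0)

/-- `lim_n sup_{P ∈ Pfam} E_P[U(-α |S_i|)⁻ 1_{|S_i| > n}] = 0` for all `i` and all `α > 0`
(`ENNReal.ofReal (-a)` is the negative part of `a`). -/
def UniformlyIntegrableLosses {N : ℕ} (U : ℝ → ℝ) (Pfam : Set (ProbabilityMeasure (Path N))) :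
    Prop :=
  ∀ i : Fin N, ∀ α : ℝ, 0 < α →
    Tendsto (fun n : ℕ => ⨆ P ∈ Pfam, ∫⁻ ω in {ω : Path N | (n : ℝ) < |ω i|},
      ENNReal.ofReal (-U (-(α * |ω i|))) ∂(P : Measure (Path N))) atTop (𝓝 0)

/-- The dual objective `J_{V,Pfam}(λQ) - λ E_Q[Ψ] + λ x`, where `V` is the conjugate of `U`. -/
def dualObjective {N : ℕ} (U : ℝ → ℝ) (Pfam : Set (ProbabilityMeasure (Path N)))
    (Ψ : Path N → ℝ) (x lam : ℝ) (Q : ProbabilityMeasure (Path N)) : EReal :=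
  robustDivergence (conj U) Pfam (ENNReal.ofReal lam • (Q : Measure (Path N)))
    - ((lam * ∫ ω, Ψ ω ∂(Q : Measure (Path N)) : ℝ) : EReal) + ((lam * x : ℝ) : EReal)

end Semistatic

end

/-! The inequality `≤` is Fenchel's inequality: under a martingale measure with the prescribed
marginals every semistatic gain has mean zero (`integral_gain_eq_zero`), so `E_P[U(X)] ≤ J_V(λQ|P) +
λ E_Q[X]` for terminal wealth `X` depends on the strategy only on the left
(`robustValue_le_dualObjective`).

For equality and attainment, let `u` be the primal value. Upper semicontinuity of `Ψ` and the
uniform integrability of losses make expected utility lower semicontinuous in the model. It is also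
affine in the model and concave in the strategy, so the minimax theorem
`exists_forall_le_of_concave` gives one model `P` in which no strategy exceeds `u`.

With `P` fixed, expected utility is a concave functional on the functions of linear growth, bounded
by `u` on the affine space of attainable wealths. Hahn–Banach (`exists_linear_majorant`) yields an
affine majorant constant on that space. Its linear part is positive and continuous under dominated
convergence, hence is a finite measure `ν ≪ P` by a Daniell argument (`exists_dual_measure`).
Maximising pointwise over bounded positions shows that `ν` attains the bound (`eexp_conj_le`). Since
`ν` annihilates all gains, its normalisation is a martingale measure with the right marginals
(`mem_martingaleMeasures_of_integral_gain`).

It remains to exclude `ν = 0`. In that case `U ≤ u` everywhere, while the measure of finite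
divergence given by hypothesis keeps attainable utilities strictly below `u`, because the conjugate
has slope `-∞` at zero (`exists_lt_integral_utility_le`). -/

namespace Semistatic

/-! ### Minimax and Hahn–Banach for concave functionals -/

section Convexity

/-- A minimax theorem: if a payoff is lower semicontinuous and affine on a compact set in its first
variable and concave in its second, and no `s` guarantees more than `u`, then a single point of the
compact set keeps the payoff below `u` for every `s`. -/
theorem exists_forall_le_of_concave {α S : Type*} [TopologicalSpace α] [AddCommGroup S]
    [Module ℝ S] {K : Set α} (hK : IsCompact K) (F : α → S → ℝ)
    (hlsc : ∀ s, LowerSemicontinuousOn (fun P => F P s) K)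
    (haff : ∀ P ∈ K, ∀ Q ∈ K, ∀ a b : ℝ, 0 ≤ a → 0 ≤ b → a + b = 1 →
      ∃ R ∈ K, ∀ s, F R s = a * F P s + b * F Q s)
    (hconc : ∀ P ∈ K, ConcaveOn ℝ univ (F P)) (u : ℝ)
    (h : ∀ s, ∀ ε > 0, ∃ P ∈ K, F P s < u + ε) : ∃ P ∈ K, ∀ s, F P s ≤ u := by
  classical
  by_contra! hcon
  choose! σ hσ using hcon
  obtain ⟨P₀, hP₀, -⟩ := h 0 1 one_pos
  -- The midpoint between `u` and the payoff of `σ P` is still exceeded near `P`, and over a finite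
  -- subcover it leaves a uniform gap `δ` above `u`.
  obtain ⟨t, ht, hcov⟩ := hK.elim_nhdsWithin_subcover
    (fun P => {R | (F P (σ P) + u) / 2 < F R (σ P)})
    (fun P hP => hlsc (σ P) P hP _ (by have := hσ P hP; linarith))
  have htne : t.Nonempty := by
    obtain ⟨P, hP, -⟩ := mem_iUnion₂.1 (hcov hP₀)
    exact ⟨P, hP⟩
  obtain ⟨δ, hδ, hδt⟩ : ∃ δ > 0, ∀ P ∈ t, u + δ ≤ (F P (σ P) + u) / 2 := by
    obtain ⟨P, hP, hmin⟩ := t.exists_min_image (fun P => F P (σ P)) htne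
    refine ⟨(F P (σ P) - u) / 2, by have := hσ P (ht P hP); linarith, fun Q hQ => ?_⟩
    have := hmin Q hQ
    linarith
  have hex : ∀ R ∈ K, ∃ j : t, u + δ < F R (σ j) := fun R hR => by
    obtain ⟨P, hP, hPR⟩ := mem_iUnion₂.1 (hcov hR)
    exact ⟨⟨P, hP⟩, (hδt P hP).trans_lt hPR⟩
  have hAopen : IsOpen {y : t → ℝ | ∀ j, y j < u + δ} := by
    simp only [ofPred_forall]
    exact isOpen_iInter_of_finite fun j => isOpen_lt (continuous_apply j) continuous_const
  have hAconv : Convex ℝ {y : t → ℝ | ∀ j, y j < u + δ} := by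
    simp only [ofPred_forall]
    exact convex_iInter fun j => convex_halfSpace_lt (LinearMap.proj j).isLinear _
  have hBconv : Convex ℝ ((fun R (j : t) => F R (σ j)) '' K) := by
    rintro _ ⟨P, hP, rfl⟩ _ ⟨Q, hQ, rfl⟩ a b ha hb hab
    obtain ⟨R, hR, hRs⟩ := haff P hP Q hQ a b ha hb hab
    exact ⟨R, hR, by ext j; simp [hRs]⟩
  have hdisj : Disjoint {y : t → ℝ | ∀ j, y j < u + δ} ((fun R (j : t) => F R (σ j)) '' K) := by
    rw [Set.disjoint_left]
    rintro _ hy ⟨R, hR, rfl⟩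
    obtain ⟨j, hj⟩ := hex R hR
    exact (hy j).not_gt hj
  -- Separation in the finite-dimensional space of payoff vectors: the orthant is unbounded below in
  -- each coordinate, which forces nonnegative weights.
  obtain ⟨f, v, hfA, hfB⟩ := geometric_hahn_banach_open hAconv hAopen hBconv hdisj
  set w : t → ℝ := fun j => f (Pi.single j 1) with hw
  have hf : ∀ y, f y = ∑ j, w j * y j := fun y => by
    conv_lhs => rw [pi_eq_sum_univ' y]
    rw [map_sum]
    refine Finset.sum_congr rfl fun j _ => ?_
    rw [map_smul, smul_eq_mul, mul_comm]
  have hw0 : ∀ j, 0 ≤ w j := fun j => by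
    by_contra! hneg
    have key : ∀ r : ℝ, 0 ≤ r → f (fun _ => u) + r * (-w j) < v := fun r hr => by
      have := hfA ((fun _ => u) - r • Pi.single j 1) (fun i => by
        have : 0 ≤ (Pi.single j 1 : t → ℝ) i := by
          rw [Pi.single_apply]; split_ifs <;> norm_num
        have := mul_nonneg hr this
        simp only [Pi.sub_apply, Pi.smul_apply, smul_eq_mul]
        linarith)
      rw [map_sub, map_smul, smul_eq_mul] at this
      simp only [hw]
      linarith
    have h0 := key 0 le_rfl
    have h1 := key ((v - f (fun _ => u)) / (-w j)) (div_nonneg (by linarith) (by linarith))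
    rw [div_mul_cancel₀ _ (by linarith)] at h1
    linarith
  set W := ∑ j, w j with hW
  have hconst : ∀ r : ℝ, f (fun _ => r) = W * r := fun r => by rw [hf, hW, Finset.sum_mul]
  have hvB : ∀ R ∈ K, v ≤ ∑ j, w j * F R (σ j) := fun R hR => by
    have := hfB _ ⟨R, hR, rfl⟩
    rwa [hf] at this
  have hWpos : 0 < W := by
    refine (Finset.sum_nonneg fun j _ => hw0 j).lt_of_ne fun hz => ?_
    have hz' : ∀ j, w j = 0 := fun j =>
      (Finset.sum_eq_zero_iff_of_nonneg fun j _ => hw0 j).1 hz.symm j (Finset.mem_univ j)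
    have h1 := hvB P₀ hP₀
    have h2 := hfA (fun _ => u) fun _ => by linarith
    rw [hf] at h2
    simp only [hz', zero_mul, Finset.sum_const_zero] at h1 h2
    linarith
  have hv : W * (u + δ) ≤ v := by
    refine le_of_forall_pos_lt_add fun ε hε => ?_
    have := hfA (fun _ => u + δ - ε / W) fun _ => by
      have := div_pos hε hWpos
      linarith
    rw [hconst, mul_sub, mul_div_cancel₀ _ hWpos.ne'] at this
    linarith
  -- By concavity the mixture with normalised weights guarantees `u + δ` on all of `K`, against `h`.
  obtain ⟨R, hR, hRlt⟩ := h (∑ j, (w j / W) • σ j) δ hδ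
  have h1 := (hconc R hR).le_map_sum (t := Finset.univ) (w := fun j => w j / W)
    (p := fun j : t => σ j) (fun j _ => div_nonneg (hw0 j) hWpos.le)
    (by rw [← Finset.sum_div, div_self hWpos.ne']) (fun _ _ => mem_univ _)
  have h2 : ∑ j, (w j / W) • F R (σ j) = (∑ j, w j * F R (σ j)) / W := by
    rw [Finset.sum_div]
    exact Finset.sum_congr rfl fun j _ => by rw [smul_eq_mul]; ring
  rw [h2] at h1
  have h3 : u + δ ≤ (∑ j, w j * F R (σ j)) / W := by
    rw [le_div_iff₀ hWpos]
    linarith [hvB R hR]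
  linarith

open scoped Pointwise in
/-- A concave function bounded by `u` on an affine subspace `X₀ + G` has an affine majorant which
equals `u` on `X₀ + G`. -/
theorem exists_linear_majorant {E : Type*} [AddCommGroup E] [Module ℝ E] {φ : E → ℝ}
    (hφ : ConcaveOn ℝ univ φ) (G : Submodule ℝ E) (X₀ : E) (u : ℝ)
    (h : ∀ g ∈ G, φ (X₀ + g) ≤ u) :
    ∃ l : E →ₗ[ℝ] ℝ, (∀ g ∈ G, l g = 0) ∧ ∀ X, φ X ≤ u + l (X - X₀) := by
  -- The infimum of `A X` is the sublinear functional for Hahn–Banach: the gap to `u` per unit step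
  -- along `-X` from the affine subspace. Concavity gives subadditivity; the bound `h` gives
  -- nonnegativity on `G`.
  let A : E → Set ℝ := fun X => {r | ∃ t : ℝ, 0 < t ∧ ∃ g ∈ G, r = (u - φ (X₀ + g - t • X)) / t}
  have hAne : ∀ X, (A X).Nonempty := fun X => ⟨_, 1, one_pos, 0, G.zero_mem, rfl⟩
  have hadd : ∀ X Y, ∀ a ∈ A X, ∀ b ∈ A Y, ∃ c ∈ A (X + Y), c ≤ a + b := by
    rintro X Y _ ⟨t, ht, g, hg, rfl⟩ _ ⟨s, hs, g', hg', rfl⟩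
    have hts : 0 < t + s := add_pos ht hs
    -- The weights `s/(t+s)` and `t/(t+s)` bring the steps `t` and `s` to this common length.
    refine ⟨_, ⟨t * s / (t + s), div_pos (mul_pos ht hs) hts,
      (s / (t + s)) • g + (t / (t + s)) • g',
      G.add_mem (G.smul_mem _ hg) (G.smul_mem _ hg'), rfl⟩, ?_⟩
    have hsum : s / (t + s) + t / (t + s) = 1 := by field_simp; ring
    have key := hφ.2 (mem_univ (X₀ + g - t • X)) (mem_univ (X₀ + g' - s • Y))
      (div_nonneg hs.le hts.le) (div_nonneg ht.le hts.le) hsum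
    have heq : (s / (t + s)) • (X₀ + g - t • X) + (t / (t + s)) • (X₀ + g' - s • Y)
        = X₀ + ((s / (t + s)) • g + (t / (t + s)) • g') - (t * s / (t + s)) • (X + Y) := by
      have h1 : X₀ = (s / (t + s)) • X₀ + (t / (t + s)) • X₀ := by
        rw [← add_smul, hsum, one_smul]
      conv_rhs => rw [h1]
      have h2 : s / (t + s) * t = t * s / (t + s) := by ring
      have h3 : t / (t + s) * s = t * s / (t + s) := by ring
      simp only [smul_sub, smul_add, smul_smul, h2, h3]
      abel
    rw [heq, smul_eq_mul, smul_eq_mul] at key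
    rw [div_le_iff₀ (div_pos (mul_pos ht hs) hts)]
    have : ((u - φ (X₀ + g - t • X)) / t + (u - φ (X₀ + g' - s • Y)) / s) * (t * s / (t + s))
        = u - (s / (t + s) * φ (X₀ + g - t • X) + t / (t + s) * φ (X₀ + g' - s • Y)) := by
      field_simp
      ring
    linarith
  have hAG : ∀ g ∈ G, ∀ a ∈ A g, 0 ≤ a := by
    rintro g hg _ ⟨t, ht, g', hg', rfl⟩
    refine div_nonneg ?_ ht.le
    have := h (g' - t • g) (G.sub_mem hg' (G.smul_mem _ hg))
    rw [← add_sub_assoc] at this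
    linarith
  have hbdd : ∀ X, BddBelow (A X) := fun X => by
    obtain ⟨b, hb⟩ := hAne (-X)
    refine ⟨-b, fun a ha => ?_⟩
    obtain ⟨c, hc, hcab⟩ := hadd X (-X) a ha b hb
    rw [add_neg_cancel] at hc
    linarith [hAG 0 G.zero_mem c hc]
  have hom : ∀ c : ℝ, 0 < c → ∀ X, sInf (A (c • X)) = c * sInf (A X) := fun c hc X => by
    have : A (c • X) = c • A X := by
      ext r
      simp only [A, mem_smul_set, mem_ofPred_eq]
      constructor
      · rintro ⟨t, ht, g, hg, rfl⟩
        refine ⟨_, ⟨t * c, mul_pos ht hc, g, hg, rfl⟩, ?_⟩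
        rw [smul_smul, smul_eq_mul]
        field_simp
      · rintro ⟨_, ⟨t, ht, g, hg, rfl⟩, rfl⟩
        refine ⟨t / c, div_pos ht hc, g, hg, ?_⟩
        rw [smul_smul, smul_eq_mul, div_mul_cancel₀ _ hc.ne']
        field_simp
    rw [this, Real.sInf_smul_of_nonneg hc.le, smul_eq_mul]
  have hsub : ∀ X Y, sInf (A (X + Y)) ≤ sInf (A X) + sInf (A Y) := fun X Y => by
    refine le_of_forall_pos_lt_add fun ε hε => ?_
    obtain ⟨a, ha, hal⟩ := exists_lt_of_csInf_lt (hAne X)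
      (show sInf (A X) < sInf (A X) + ε / 2 by linarith)
    obtain ⟨b, hb, hbl⟩ := exists_lt_of_csInf_lt (hAne Y)
      (show sInf (A Y) < sInf (A Y) + ε / 2 by linarith)
    obtain ⟨c, hc, hcab⟩ := hadd X Y a ha b hb
    have := csInf_le (hbdd _) hc
    linarith
  obtain ⟨l, hlG, hl⟩ := exists_extension_of_le_sublinear (⟨G, 0⟩ : E →ₗ.[ℝ] ℝ)
    (fun X => sInf (A X)) hom hsub (fun g => le_csInf (hAne _) fun a ha => hAG g g.2 a ha)
  refine ⟨l, fun g hg => hlG ⟨g, hg⟩, fun X => ?_⟩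
  -- In direction `X₀ - X`, the step `t = 1` with `g = 0` lands exactly on `X`.
  have h1 := (hl (X₀ - X)).trans (csInf_le (hbdd _) ⟨1, one_pos, 0, G.zero_mem, rfl⟩)
  rw [add_zero, one_smul, sub_sub_cancel, div_one, ← neg_sub X X₀, map_neg] at h1
  linarith

end Convexity

/-! ### Utility functions and their conjugates -/

section Utility

variable {U : ℝ → ℝ}

theorem IsInadaUtility.le_tangent (hU : IsInadaUtility U) (x y : ℝ) :
    U y ≤ U x + deriv U x * (y - x) := by
  have hd := (hU.differentiable x).hasDerivAt
  rcases lt_trichotomy x y with h | rfl | h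
  · have := hU.strictConcave.concaveOn.slope_le_of_hasDerivAt (mem_univ x) (mem_univ y) h hd
    rw [slope_def_field, div_le_iff₀ (sub_pos.2 h)] at this
    linarith
  · simp
  · have := hU.strictConcave.concaveOn.le_slope_of_hasDerivAt (mem_univ y) (mem_univ x) h hd
    rw [slope_def_field, le_div_iff₀ (sub_pos.2 h)] at this
    linarith

/-- A descent somewhere would, by concavity, keep all later slopes below a negative number, against
`U' → 0`. Equal values at two points would put the midpoint strictly above the right endpoint. -/
theorem IsInadaUtility.strictMono (hU : IsInadaUtility U) : StrictMono U := by
  have hmono : Monotone U := by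
    intro x y hxy
    by_contra! hlt
    have hne : 0 < y - x := by
      rcases hxy.eq_or_lt with rfl | h
      · exact absurd hlt (lt_irrefl _)
      · linarith
    have hev : ∀ᶠ z in atTop, -((U x - U y) / (y - x)) < deriv U z :=
      hU.deriv_atTop.eventually_const_lt (by have := div_pos (sub_pos.2 hlt) hne; linarith)
    obtain ⟨z, hz, hyz⟩ := (hev.and (eventually_gt_atTop y)).exists
    have h1 := hU.le_tangent z y
    have h2 := hU.strictConcave.concaveOn.slope_anti_adjacent (mem_univ x) (mem_univ z)
      (sub_pos.1 hne) hyz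
    have h3 : (U y - U x) / (y - x) = -((U x - U y) / (y - x)) := by ring
    rw [h3, div_le_iff₀ (sub_pos.2 hyz)] at h2
    have := mul_lt_mul_of_pos_right hz (sub_pos.2 hyz)
    nlinarith
  intro x y hxy
  refine (hmono hxy.le).lt_of_ne fun heq => ?_
  have hm := hU.strictConcave.2 (mem_univ x) (mem_univ y) hxy.ne
    (by norm_num : (0 : ℝ) < 1 / 2) (by norm_num : (0 : ℝ) < 1 / 2) (by norm_num)
  simp only [smul_eq_mul] at hm
  have := hmono (show 1 / 2 * x + 1 / 2 * y ≤ y by linarith)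
  linarith

theorem IsInadaUtility.deriv_nonneg (hU : IsInadaUtility U) (x : ℝ) : 0 ≤ deriv U x :=
  hU.strictMono.monotone.deriv_nonneg

theorem IsInadaUtility.abs_le (hU : IsInadaUtility U) {x y : ℝ} (hxy : |x| ≤ y) :
    |U x| ≤ |U (-y)| + |U 0| + deriv U 0 * y := by
  have hy : 0 ≤ y := (abs_nonneg x).trans hxy
  have h0 := mul_nonneg (hU.deriv_nonneg 0) hy
  have h1 := hU.strictMono.monotone (_root_.abs_le.1 hxy).1
  have h2 := hU.le_tangent 0 x
  have h3 := mul_le_mul_of_nonneg_left ((le_abs_self x).trans hxy) (hU.deriv_nonneg 0)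
  rw [sub_zero] at h2
  refine _root_.abs_le.2 ⟨?_, ?_⟩
  · linarith [neg_abs_le (U (-y)), abs_nonneg (U 0)]
  · linarith [le_abs_self (U 0), abs_nonneg (U (-y))]

/-- Losses eventually dominate any linear function. -/
theorem IsInadaUtility.exists_mul_le (hU : IsInadaUtility U) (b : ℝ) :
    ∃ C : ℝ, ∀ y, 0 ≤ y → b * y ≤ -U (-y) + C := by
  obtain ⟨x, hx⟩ := (hU.deriv_atBot.eventually_ge_atTop b).exists
  refine ⟨U x - deriv U x * x, fun y hy => ?_⟩
  have h1 := hU.le_tangent x (-y)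
  have h2 := mul_le_mul_of_nonneg_right hx hy
  linarith

theorem le_conj (U : ℝ → ℝ) (x y : ℝ) : ((U x - x * y : ℝ) : EReal) ≤ conj U y :=
  le_iSup (fun x : ℝ => ((U x - x * y : ℝ) : EReal)) x

theorem conj_eq_iSup_rat (hU : Continuous U) (y : ℝ) :
    conj U y = ⨆ q : ℚ, ((U q - q * y : ℝ) : EReal) := by
  refine le_antisymm (iSup_le fun x => le_of_forall_lt fun c hc => ?_)
    (iSup_le fun q => le_conj U q y)
  have hcont : Continuous fun x : ℝ => ((U x - x * y : ℝ) : EReal) :=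
    continuous_coe_real_ereal.comp (by fun_prop)
  obtain ⟨q, hq⟩ := Rat.denseRange_cast.exists_mem_open (isOpen_lt continuous_const hcont) ⟨x, hc⟩
  exact lt_of_lt_of_le hq (le_iSup (fun q : ℚ => ((U q - q * y : ℝ) : EReal)) q)

theorem measurable_conj (hU : Continuous U) : Measurable (conj U) := by
  rw [funext (conj_eq_iSup_rat hU)]
  exact Measurable.iSup fun q => measurable_coe_real_ereal.comp (by fun_prop)

end Utility

/-! ### Extended-real expectations -/

section ExtendedExpectation

theorem ofReal_max_zero (a : ℝ) : ENNReal.ofReal (max a 0) = ENNReal.ofReal a := by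
  rcases le_total a 0 with h | h <;> simp [h, ENNReal.ofReal_of_nonpos]

variable {Ω : Type*} [MeasurableSpace Ω] {P : Measure Ω}

theorem eexp_mono {f g : Ω → EReal} (h : ∀ ω, f ω ≤ g ω) : eexp P f ≤ eexp P g :=
  EReal.sub_le_sub
    (EReal.coe_ennreal_le_coe_ennreal_iff.2
      (lintegral_mono fun ω => EReal.toENNReal_le_toENNReal (h ω)))
    (EReal.coe_ennreal_le_coe_ennreal_iff.2
      (lintegral_mono fun ω => EReal.toENNReal_le_toENNReal (EReal.neg_le_neg_iff.2 (h ω))))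

theorem eexp_coe {f : Ω → ℝ} (hf : Integrable f P) :
    eexp P (fun ω => (f ω : EReal)) = ((∫ ω, f ω ∂P : ℝ) : EReal) := by
  have h1 : ∫⁻ ω, ENNReal.ofReal (f ω) ∂P ≠ ⊤ := hf.lintegral_lt_top.ne
  have h2 : ∫⁻ ω, ENNReal.ofReal (-f ω) ∂P ≠ ⊤ := hf.neg.lintegral_lt_top.ne
  rw [eexp, integral_eq_lintegral_pos_part_sub_lintegral_neg_part hf]
  simp only [← EReal.coe_neg, EReal.real_coe_toENNReal]
  rw [EReal.coe_sub, EReal.coe_ennreal_toReal h1, EReal.coe_ennreal_toReal h2]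

/-- The extended expectation of a function bounded below, in terms of a nonnegative integral. -/
theorem eexp_eq_lintegral_sub_add [IsProbabilityMeasure P] {f : Ω → EReal} (hf : Measurable f)
    {c : ℝ} (hc : ∀ ω, (c : EReal) ≤ f ω) :
    eexp P f = ((∫⁻ ω, (f ω - c).toENNReal ∂P : ℝ≥0∞) : EReal) + c := by
  have hm1 : Measurable fun ω => (f ω).toENNReal := hf.ereal_toENNReal
  have hm2 : Measurable fun ω => (-f ω).toENNReal := hf.neg.ereal_toENNReal
  have hm3 : Measurable fun ω => (f ω - c).toENNReal :=
    (hf.sub_const _).ereal_toENNReal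
  have hpt : ∀ ω, (f ω).toENNReal + ENNReal.ofReal (-c)
      = (f ω - c).toENNReal + (ENNReal.ofReal c + (-f ω).toENNReal) := fun ω => by
    have := hc ω
    induction hfw : f ω with
    | bot => rw [hfw] at this; simp at this
    | top => simp
    | coe r =>
      rw [hfw, EReal.coe_le_coe_iff] at this
      simp only [← EReal.coe_sub, ← EReal.coe_neg, EReal.real_coe_toENNReal]
      have h1 : ENNReal.ofReal (r - c) + ENNReal.ofReal c + ENNReal.ofReal (-r)
          = ENNReal.ofReal (r - c + max c 0 + max (-r) 0) := by
        rw [← ofReal_max_zero c, ← ofReal_max_zero (-r), ENNReal.ofReal_add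
          (by positivity) (by positivity), ENNReal.ofReal_add (by linarith) (by positivity)]
      rw [← add_assoc, h1, ← ofReal_max_zero r, ← ofReal_max_zero (-c),
        ← ENNReal.ofReal_add (by positivity) (by positivity)]
      congr 1
      have h2 := max_zero_sub_max_neg_zero_eq_self r
      have h3 := max_zero_sub_max_neg_zero_eq_self c
      linarith
  have hD : ∫⁻ ω, (-f ω).toENNReal ∂P ≠ ⊤ := by
    refine ne_top_of_le_ne_top (b := ENNReal.ofReal (-c)) ENNReal.ofReal_ne_top ?_
    calc ∫⁻ ω, (-f ω).toENNReal ∂P ≤ ∫⁻ _, ENNReal.ofReal (-c) ∂P := by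
          refine lintegral_mono fun ω => ?_
          rw [← EReal.real_coe_toENNReal, EReal.coe_neg]
          exact EReal.toENNReal_le_toENNReal (EReal.neg_le_neg_iff.2 (hc ω))
      _ = _ := by simp
  have hint := lintegral_congr (μ := P) hpt
  rw [lintegral_add_left hm1, lintegral_add_left hm3, lintegral_add_left measurable_const] at hint
  simp only [lintegral_const, measure_univ, mul_one] at hint
  rw [eexp]
  set A := ∫⁻ ω, (f ω).toENNReal ∂P
  set B := ∫⁻ ω, (f ω - c).toENNReal ∂P
  set D := ∫⁻ ω, (-f ω).toENNReal ∂P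
  rcases eq_or_ne B ⊤ with hB | hB
  · have hA : A = ⊤ := by
      rw [hB, top_add] at hint
      exact (ENNReal.add_eq_top.1 hint).resolve_right ENNReal.ofReal_ne_top
    rw [hA, hB, ← EReal.coe_ennreal_toReal hD]
    simp
  · have hA : A ≠ ⊤ := fun hA => by
      rw [hA, top_add, eq_comm] at hint
      simp [ENNReal.add_eq_top, hB, hD] at hint
    have := congrArg ENNReal.toReal hint
    rw [ENNReal.toReal_add hA ENNReal.ofReal_ne_top, ENNReal.toReal_add hB (by simp [hD]),
      ENNReal.toReal_add ENNReal.ofReal_ne_top hD, ENNReal.toReal_ofReal',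
      ENNReal.toReal_ofReal'] at this
    rw [← EReal.coe_ennreal_toReal hA, ← EReal.coe_ennreal_toReal hB, ← EReal.coe_ennreal_toReal hD,
      ← EReal.coe_sub, ← EReal.coe_add, EReal.coe_eq_coe_iff]
    have h3 := max_zero_sub_max_neg_zero_eq_self c
    linarith

end ExtendedExpectation

/-! ### Functions of controlled growth and Daniell representation -/

section GrowthSpace

variable {Ω : Type*} [MeasurableSpace Ω]

/-- Measurable functions dominated by a multiple of the weight `w`. -/
def growthSpace (w : Ω → ℝ) : Submodule ℝ (Ω → ℝ) where
  carrier := {X | Measurable X ∧ ∃ C : ℝ, ∀ ω, |X ω| ≤ C * w ω}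
  zero_mem' := ⟨measurable_const, 0, fun ω => by simp⟩
  add_mem' := by
    rintro X Y ⟨hX, C, hC⟩ ⟨hY, D, hD⟩
    refine ⟨hX.add hY, C + D, fun ω => ?_⟩
    rw [add_mul]
    exact (abs_add_le _ _).trans (add_le_add (hC ω) (hD ω))
  smul_mem' := by
    rintro a X ⟨hX, C, hC⟩
    refine ⟨hX.const_smul a, |a| * C, fun ω => ?_⟩
    rw [Pi.smul_apply, smul_eq_mul, abs_mul, mul_assoc]
    exact mul_le_mul_of_nonneg_left (hC ω) (abs_nonneg a)

theorem growthSpace_of_bounded {w X : Ω → ℝ} (hw : ∀ ω, 1 ≤ w ω) (hX : Measurable X) {C : ℝ}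
    (hC : ∀ ω, |X ω| ≤ C) : X ∈ growthSpace w :=
  ⟨hX, C, fun ω => (hC ω).trans
    (le_mul_of_one_le_right ((abs_nonneg _).trans (hC ω)) (hw ω))⟩

theorem integrable_of_mem_growthSpace {w X : Ω → ℝ} {ν : Measure Ω} (hw : Integrable w ν)
    (hX : X ∈ growthSpace w) : Integrable X ν := by
  obtain ⟨hm, C, hC⟩ := hX
  exact (hw.const_mul C).mono' hm.aestronglyMeasurable (.of_forall hC)

theorem measurable_indicator_one {A : Set Ω} (hA : MeasurableSet A) :
    Measurable (A.indicator (1 : Ω → ℝ)) :=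
  measurable_one.indicator hA

theorem abs_indicator_one_le {α : Type*} (A : Set α) (ω : α) :
    |A.indicator (1 : α → ℝ) ω| ≤ 1 := by
  by_cases h : ω ∈ A <;> simp [h]

/-- A Daniell-type representation: a positive linear functional on the functions of growth `w`
which is continuous under dominated pointwise convergence is given by a finite measure. -/
theorem exists_measure_of_linear {w : Ω → ℝ} (hwm : Measurable w) (hw : ∀ ω, 1 ≤ w ω)
    (l : (Ω → ℝ) →ₗ[ℝ] ℝ) (hpos : ∀ X ∈ growthSpace w, (∀ ω, 0 ≤ X ω) → 0 ≤ l X)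
    (hcont : ∀ D : ℕ → Ω → ℝ, (∀ n, Measurable (D n)) → (∃ C : ℝ, ∀ n ω, |D n ω| ≤ C * w ω) →
      (∀ ω, Tendsto (fun n => D n ω) atTop (𝓝 0)) → Tendsto (fun n => l (D n)) atTop (𝓝 0)) :
    ∃ ν : Measure Ω, IsFiniteMeasure ν ∧ Integrable w ν ∧
      (∀ X ∈ growthSpace w, l X = ∫ ω, X ω ∂ν) := by
  have hind : ∀ {A : Set Ω}, MeasurableSet A → A.indicator (1 : Ω → ℝ) ∈ growthSpace w :=
    fun {A} hA => growthSpace_of_bounded hw (measurable_indicator_one hA) (abs_indicator_one_le A)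
  have hind0 : ∀ {A : Set Ω}, MeasurableSet A → 0 ≤ l (A.indicator 1) := fun {A} hA =>
    hpos _ (hind hA) fun ω => indicator_nonneg (fun _ _ => zero_le_one) ω
  -- Countable additivity is `hcont` applied to the indicators of the tails `⋃_{i ≥ n} f i`, which
  -- tend to zero pointwise by disjointness.
  let ν : Measure Ω := Measure.ofMeasurable (fun A _ => ENNReal.ofReal (l (A.indicator 1)))
    (by rw [indicator_empty', map_zero, ENNReal.ofReal_zero]) (by
      intro f hf hdisj
      have hsum : ∀ n, l ((⋃ i, f i).indicator 1) = ∑ i ∈ Finset.range n, l ((f i).indicator 1)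
          + l ((⋃ i, ⋃ _ : n ≤ i, f i).indicator 1) := fun n => by
        rw [← map_sum, ← map_add]
        congr 1
        ext ω
        simp only [Pi.add_apply, Finset.sum_apply]
        by_cases hω : ω ∈ ⋃ i, f i
        · obtain ⟨i, hi⟩ := mem_iUnion.1 hω
          have hne : ∀ j, j ≠ i → ω ∉ f j := fun j hj hj' =>
            (hdisj hj).le_bot ⟨hj', hi⟩
          rw [indicator_of_mem hω]
          by_cases hin : i < n
          · rw [Finset.sum_eq_single i (fun j _ hj => indicator_of_notMem (hne j hj) _)
              (fun h => absurd (Finset.mem_range.2 hin) h), indicator_of_mem hi,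
              indicator_of_notMem, add_zero]
            intro hmem
            obtain ⟨j, hj, hjω⟩ := mem_iUnion₂.1 hmem
            exact hne j (by omega) hjω
          · rw [Finset.sum_eq_zero, zero_add, indicator_of_mem]
            · exact mem_iUnion₂.2 ⟨i, not_lt.1 hin, hi⟩
            · exact fun j hj => indicator_of_notMem
                (hne j (by have := Finset.mem_range.1 hj; omega)) _
        · have hne : ∀ j, ω ∉ f j := fun j hj => hω (mem_iUnion.2 ⟨j, hj⟩)
          rw [indicator_of_notMem hω, Finset.sum_eq_zero fun j _ => indicator_of_notMem (hne j) _,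
            indicator_of_notMem, add_zero]
          intro hmem
          obtain ⟨j, -, hjω⟩ := mem_iUnion₂.1 hmem
          exact hne j hjω
      have htail : Tendsto (fun n => l ((⋃ i, ⋃ _ : n ≤ i, f i).indicator 1)) atTop (𝓝 0) := by
        refine hcont _ (fun n => measurable_indicator_one
          (.iUnion fun i => .iUnion fun _ => hf i)) ⟨1, fun n ω => ?_⟩ fun ω => ?_
        · rw [one_mul]
          exact (abs_indicator_one_le _ ω).trans (hw ω)
        · refine tendsto_const_nhds.congr' ?_
          by_cases hω : ∃ i, ω ∈ f i
          · obtain ⟨i, hi⟩ := hω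
            filter_upwards [eventually_gt_atTop i] with n hn
            rw [indicator_of_notMem]
            intro hmem
            obtain ⟨j, hj, hjω⟩ := mem_iUnion₂.1 hmem
            exact (hdisj (show j ≠ i by omega)).le_bot ⟨hjω, hi⟩
          · refine .of_forall fun n => (indicator_of_notMem ?_ _).symm
            intro hmem
            obtain ⟨j, -, hjω⟩ := mem_iUnion₂.1 hmem
            exact hω ⟨j, hjω⟩
      have hS : HasSum (fun i => l ((f i).indicator 1)) (l ((⋃ i, f i).indicator 1)) := by
        rw [hasSum_iff_tendsto_nat_of_nonneg fun i => hind0 (hf i)]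
        have := tendsto_const_nhds (x := l ((⋃ i, f i).indicator 1)) |>.sub htail
        rw [sub_zero] at this
        exact this.congr fun n => by rw [hsum n]; ring
      rw [← hS.tsum_eq, ENNReal.ofReal_tsum_of_nonneg (fun i => hind0 (hf i)) hS.summable])
  have hν : ∀ A, MeasurableSet A → ν A = ENNReal.ofReal (l (A.indicator 1)) := fun A hA =>
    Measure.ofMeasurable_apply A hA
  have hfin : IsFiniteMeasure ν := ⟨by rw [hν _ .univ]; exact ENNReal.ofReal_lt_top⟩
  have hsimple_mem : ∀ g : SimpleFunc Ω ℝ, (g : Ω → ℝ) ∈ growthSpace w := fun g => by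
    obtain ⟨C, hC⟩ := g.exists_forall_norm_le
    exact growthSpace_of_bounded hw g.measurable hC
  have hsimple : ∀ g : SimpleFunc Ω ℝ, l g = ∫ ω, g ω ∂ν := fun g => by
    induction g using SimpleFunc.induction with
    | const c hs =>
      rename_i s
      have : (SimpleFunc.piecewise s hs (SimpleFunc.const Ω c) (SimpleFunc.const Ω 0) : Ω → ℝ)
          = c • s.indicator 1 := by
        ext ω
        by_cases h : ω ∈ s <;> simp [h]
      rw [this, map_smul]
      simp only [Pi.smul_apply, smul_eq_mul]
      rw [integral_const_mul, integral_indicator_one hs, Measure.real, hν s hs,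
        ENNReal.toReal_ofReal (hind0 hs)]
    | add hd hf hg =>
      rename_i f g
      rw [SimpleFunc.coe_add, map_add, hf, hg]
      simp only [Pi.add_apply]
      have hi : ∀ g : SimpleFunc Ω ℝ, Integrable g ν := fun g => g.integrable_of_isFiniteMeasure
      exact (integral_add (hi f) (hi g)).symm
  have hmono : ∀ X ∈ growthSpace w, ∀ Y ∈ growthSpace w, (∀ ω, X ω ≤ Y ω) → l X ≤ l Y :=
    fun X hX Y hY h => by
      have := hpos _ (Submodule.sub_mem _ hY hX) fun ω => sub_nonneg.2 (h ω)
      rw [map_sub] at this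
      linarith
  have hwmem : w ∈ growthSpace w :=
    ⟨hwm, 1, fun ω => by rw [one_mul, abs_of_nonneg (zero_le_one.trans (hw ω))]⟩
  let a : (X : Ω → ℝ) → Measurable X → ℕ → SimpleFunc Ω ℝ :=
    fun X hX n => SimpleFunc.approxOn X hX univ 0 (mem_univ 0) n
  have ha_lim : ∀ X hX ω, Tendsto (fun n => a X hX n ω) atTop (𝓝 (X ω)) := fun X hX ω =>
    SimpleFunc.tendsto_approxOn hX (mem_univ 0) (by simp)
  have ha_le : ∀ X hX n ω, |a X hX n ω| ≤ 2 * |X ω| := fun X hX n ω => by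
    have := SimpleFunc.norm_approxOn_zero_le hX (mem_univ 0) ω n
    rw [Real.norm_eq_abs, Real.norm_eq_abs] at this
    linarith
  -- Simple approximations of `w` stay below `2w`, so their integrals stay below `2 l w`, and Fatou
  -- applies. This provides the dominating function for general `X`.
  have hwint : Integrable w ν := by
    refine ⟨hwm.aestronglyMeasurable, ?_⟩
    have hle : ∀ n, ∫⁻ ω, ‖a w hwm n ω‖ₑ ∂ν ≤ ENNReal.ofReal (2 * l w) := fun n => by
      rw [← ofReal_integral_norm_eq_lintegral_enorm
        (a w hwm n).integrable_of_isFiniteMeasure]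
      refine ENNReal.ofReal_le_ofReal ?_
      have := hsimple ((a w hwm n).map fun r => ‖r‖)
      simp only [SimpleFunc.map_apply] at this
      rw [← this, ← smul_eq_mul, ← map_smul]
      refine hmono _ (hsimple_mem _) _ (Submodule.smul_mem _ _ hwmem) fun ω => ?_
      have := ha_le w hwm n ω
      rwa [abs_of_nonneg (zero_le_one.trans (hw ω))] at this
    calc ∫⁻ ω, ‖w ω‖ₑ ∂ν = ∫⁻ ω, liminf (fun n => ‖a w hwm n ω‖ₑ) atTop ∂ν := by
          refine lintegral_congr fun ω => ?_
          exact ((ha_lim w hwm ω).enorm.liminf_eq).symm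
      _ ≤ liminf (fun n => ∫⁻ ω, ‖a w hwm n ω‖ₑ ∂ν) atTop :=
          lintegral_liminf_le fun n => (a w hwm n).measurable.enorm
      _ ≤ liminf (fun _ => ENNReal.ofReal (2 * l w)) (atTop : Filter ℕ) :=
          liminf_le_liminf (.of_forall hle)
      _ < ⊤ := by rw [liminf_const]; exact ENNReal.ofReal_lt_top
  refine ⟨ν, hfin, hwint, fun X hX => ?_⟩
  obtain ⟨hXm, C, hC⟩ := hX
  have h1 : Tendsto (fun n => l (a X hXm n)) atTop (𝓝 (l X)) := by
    rw [← tendsto_sub_nhds_zero_iff]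
    simp only [← map_sub]
    refine hcont _ (fun n => (a X hXm n).measurable.sub hXm) ⟨3 * C, fun n ω => ?_⟩ fun ω => ?_
    · have := abs_sub (a X hXm n ω) (X ω)
      have := ha_le X hXm n ω
      have := hC ω
      simp only [Pi.sub_apply]
      linarith
    · simpa using! (ha_lim X hXm ω).sub_const (X ω)
  have h2 : Tendsto (fun n => ∫ ω, a X hXm n ω ∂ν) atTop (𝓝 (∫ ω, X ω ∂ν)) := by
    refine tendsto_integral_of_dominated_convergence (fun ω => 2 * (C * w ω))
      (fun n => (a X hXm n).measurable.aestronglyMeasurable) ((hwint.const_mul C).const_mul 2)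
      (fun n => .of_forall fun ω => ?_) (.of_forall fun ω => ha_lim X hXm ω)
    have := ha_le X hXm n ω
    have := hC ω
    rw [Real.norm_eq_abs]
    linarith
  exact tendsto_nhds_unique h1 (h2.congr fun n => (hsimple _).symm)

end GrowthSpace

/-! ### Duality in a single model -/

section FixedModel

variable {Ω : Type*} [MeasurableSpace Ω] {P : Measure Ω} {U : ℝ → ℝ} {w : Ω → ℝ}

theorem integrable_utility_bound [IsFiniteMeasure P] (hwint : Integrable w P)
    (hUw : ∀ C : ℝ, Integrable (fun ω => U (-(C * w ω))) P) (C : ℝ) :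
    Integrable (fun ω => |U (-(C * w ω))| + |U 0| + deriv U 0 * (C * w ω)) P :=
  ((hUw C).abs.add (integrable_const _)).add ((hwint.const_mul C).const_mul _)

theorem integrable_utility [IsFiniteMeasure P] (hU : IsInadaUtility U) (hwint : Integrable w P)
    (hUw : ∀ C : ℝ, Integrable (fun ω => U (-(C * w ω))) P) {X : Ω → ℝ}
    (hX : X ∈ growthSpace w) : Integrable (fun ω => U (X ω)) P := by
  obtain ⟨hXm, C, hC⟩ := hX
  exact (integrable_utility_bound hwint hUw C).mono'
    (hU.differentiable.continuous.measurable.comp hXm).aestronglyMeasurable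
    (.of_forall fun ω => hU.abs_le (hC ω))

theorem concave_expected_utility [IsFiniteMeasure P] (hU : IsInadaUtility U)
    (hwint : Integrable w P) (hUw : ∀ C : ℝ, Integrable (fun ω => U (-(C * w ω))) P)
    {X Y : Ω → ℝ} (hX : X ∈ growthSpace w) (hY : Y ∈ growthSpace w) {a b : ℝ} (ha : 0 ≤ a)
    (hb : 0 ≤ b) (hab : a + b = 1) :
    a * ∫ ω, U (X ω) ∂P + b * ∫ ω, U (Y ω) ∂P ≤ ∫ ω, U (a * X ω + b * Y ω) ∂P := by
  have hiX := (integrable_utility hU hwint hUw hX).const_mul a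
  have hiY := (integrable_utility hU hwint hUw hY).const_mul b
  rw [← integral_const_mul, ← integral_const_mul, ← integral_add hiX hiY]
  exact integral_mono (hiX.add hiY) (integrable_utility hU hwint hUw
    (Submodule.add_mem _ (Submodule.smul_mem _ a hX) (Submodule.smul_mem _ b hY)))
    fun ω => hU.strictConcave.concaveOn.2 (mem_univ _) (mem_univ _) ha hb hab

/-- A pointwise maximiser of finitely many affine functions can be chosen measurably. -/
theorem exists_measurable_maximiser (U : ℝ → ℝ) {Z : Ω → ℝ} (hZ : Measurable Z) (q : ℕ → ℝ)
    (n : ℕ) : ∃ X : Ω → ℝ, Measurable X ∧ (∃ s : Finset ℝ, ∀ ω, X ω ∈ s) ∧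
      (Measurable fun ω => U (X ω)) ∧
      ∀ ω, ∀ k ≤ n, U (q k) - q k * Z ω ≤ U (X ω) - X ω * Z ω := by
  classical
  induction n with
  | zero =>
    refine ⟨fun _ => q 0, measurable_const, ⟨{q 0}, fun _ => by simp⟩, measurable_const,
      fun ω k hk => ?_⟩
    rw [Nat.le_zero.1 hk]
  | succ n ih =>
    obtain ⟨X, hXm, ⟨s, hs⟩, hUX, hX⟩ := ih
    have hA : MeasurableSet {ω | U (X ω) - X ω * Z ω ≤ U (q (n + 1)) - q (n + 1) * Z ω} :=
      measurableSet_le (hUX.sub (hXm.mul hZ)) (measurable_const.sub (hZ.const_mul _))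
    refine ⟨fun ω => if U (X ω) - X ω * Z ω ≤ U (q (n + 1)) - q (n + 1) * Z ω
      then q (n + 1) else X ω, Measurable.ite hA measurable_const hXm,
      ⟨insert (q (n + 1)) s, fun ω => ?_⟩, ?_, fun ω k hk => ?_⟩
    · dsimp only
      split_ifs <;> simp [hs]
    · simp only [apply_ite U]
      exact Measurable.ite hA measurable_const hUX
    · dsimp only
      rcases hk.lt_or_eq with hk | rfl
      · have := hX ω k (by omega)
        split_ifs <;> linarith
      · split_ifs <;> linarith

/-- Fenchel's inequality, integrated. -/
theorem integral_utility_le {ν : Measure Ω} [IsFiniteMeasure ν] [IsProbabilityMeasure P]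
    (hνP : ν ≪ P) {X : Ω → ℝ} (hUX : Integrable (fun ω => U (X ω)) P) (hX : Integrable X ν) :
    ((∫ ω, U (X ω) ∂P : ℝ) : EReal) ≤
      eexp P (fun ω => conj U (ν.rnDeriv P ω).toReal) + ((∫ ω, X ω ∂ν : ℝ) : EReal) := by
  have h1 : Integrable (fun ω => (ν.rnDeriv P ω).toReal * X ω) P :=
    (integrable_toReal_rnDeriv_mul_iff hνP).2 hX
  have h2 := eexp_coe (hUX.sub h1)
  have h3 : eexp P (fun ω => ((U (X ω) - (ν.rnDeriv P ω).toReal * X ω : ℝ) : EReal)) ≤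
      eexp P (fun ω => conj U (ν.rnDeriv P ω).toReal) :=
    eexp_mono fun ω => by rw [mul_comm]; exact le_conj U _ _
  simp only [Pi.sub_apply] at h2
  rw [h2, integral_sub hUX h1, integral_toReal_rnDeriv_mul hνP, EReal.coe_sub] at h3
  exact EReal.sub_le_iff_le_add (by simp) (by simp) |>.1 h3

/-- The linear majorant of expected utility is tested along rays `X₀ + rX`. Monotonicity of `U`
makes it positive, dominated convergence makes it continuous, and insensitivity of expected utility
to `P`-null changes gives absolute continuity of the representing measure. -/
theorem exists_dual_measure [IsProbabilityMeasure P] (hU : IsInadaUtility U) (hwm : Measurable w)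
    (hw : ∀ ω, 1 ≤ w ω) (hwint : Integrable w P)
    (hUw : ∀ C : ℝ, Integrable (fun ω => U (-(C * w ω))) P) (G : Submodule ℝ (Ω → ℝ))
    (hG : G ≤ growthSpace w) {X₀ : Ω → ℝ} (hX₀ : X₀ ∈ growthSpace w) {u : ℝ}
    (h : ∀ g ∈ G, ∫ ω, U (X₀ ω + g ω) ∂P ≤ u) :
    ∃ ν : Measure Ω, IsFiniteMeasure ν ∧ ν ≪ P ∧ Integrable w ν ∧ (∀ g ∈ G, ∫ ω, g ω ∂ν = 0) ∧
      ∀ X ∈ growthSpace w, ∫ ω, U (X ω) ∂P ≤ u + ∫ ω, X ω ∂ν - ∫ ω, X₀ ω ∂ν := by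
  have hconc : ConcaveOn ℝ univ (fun X : growthSpace w => ∫ ω, U (X.1 ω) ∂P) :=
    ⟨convex_univ, fun X _ Y _ a b ha hb hab =>
      concave_expected_utility hU hwint hUw X.2 Y.2 ha hb hab⟩
  obtain ⟨l₀, hl₀G, hl₀⟩ := exists_linear_majorant hconc (G.comap (growthSpace w).subtype)
    ⟨X₀, hX₀⟩ u fun g hg => h g hg
  obtain ⟨l, hl⟩ := l₀.exists_extend
  have hll : ∀ X (hX : X ∈ growthSpace w), l₀ ⟨X, hX⟩ = l X := fun X hX => by rw [← hl]; rfl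
  have hlG : ∀ g ∈ G, l g = 0 := fun g hg => by
    rw [← hll g (hG hg)]; exact hl₀G _ hg
  have hmaj : ∀ X ∈ growthSpace w, ∫ ω, U (X ω) ∂P ≤ u + l X - l X₀ := fun X hX => by
    have := hl₀ ⟨X, hX⟩
    rw [map_sub, hll, hll] at this
    linarith
  have hpos : ∀ X ∈ growthSpace w, (∀ ω, 0 ≤ X ω) → 0 ≤ l X := fun X hX hX0 => by
    by_contra! hneg
    have key : ∀ r : ℝ, 0 ≤ r → ∫ ω, U (X₀ ω) ∂P ≤ u + r * l X := fun r hr => by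
      have hmem : X₀ + r • X ∈ growthSpace w :=
        Submodule.add_mem _ hX₀ (Submodule.smul_mem _ r hX)
      have h1 := hmaj _ hmem
      rw [map_add, map_smul, smul_eq_mul] at h1
      have h2 : ∫ ω, U (X₀ ω) ∂P ≤ ∫ ω, U ((X₀ + r • X) ω) ∂P :=
        integral_mono (integrable_utility hU hwint hUw hX₀) (integrable_utility hU hwint hUw hmem)
          fun ω => hU.strictMono.monotone (by
            have := mul_nonneg hr (hX0 ω)
            simp only [Pi.add_apply, Pi.smul_apply, smul_eq_mul]
            linarith)
      linarith
    have h0 := key 0 le_rfl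
    have h1 := key ((u - ∫ ω, U (X₀ ω) ∂P + 1) / (-l X)) (div_nonneg (by linarith) (by linarith))
    have h2 : (u - ∫ ω, U (X₀ ω) ∂P + 1) / (-l X) * l X = -(u - ∫ ω, U (X₀ ω) ∂P + 1) := by
      rw [div_neg, neg_mul, div_mul_cancel₀ _ hneg.ne]
    linarith
  have hcont : ∀ D : ℕ → Ω → ℝ, (∀ n, Measurable (D n)) →
      (∃ C : ℝ, ∀ n ω, |D n ω| ≤ C * w ω) →
      (∀ ω, Tendsto (fun n => D n ω) atTop (𝓝 0)) → Tendsto (fun n => l (D n)) atTop (𝓝 0) := by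
    intro D hDm ⟨C, hC⟩ hD
    obtain ⟨hX₀m, C₀, hC₀⟩ := hX₀
    have hmem : ∀ n, D n ∈ growthSpace w := fun n => ⟨hDm n, C, hC n⟩
    have hlim : ∀ r : ℝ, Tendsto (fun n => ∫ ω, U (X₀ ω + r * D n ω) ∂P) atTop
        (𝓝 (∫ ω, U (X₀ ω) ∂P)) := fun r => by
      refine tendsto_integral_of_dominated_convergence _
        (fun n => (hU.differentiable.continuous.measurable.comp
          (hX₀m.add ((hDm n).const_mul r))).aestronglyMeasurable)
        (integrable_utility_bound hwint hUw (C₀ + |r| * C))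
        (fun n => .of_forall fun ω => hU.abs_le ?_) (.of_forall fun ω => ?_)
      · rw [add_mul, mul_assoc]
        refine (abs_add_le _ _).trans (add_le_add (hC₀ ω) ?_)
        rw [abs_mul]
        exact mul_le_mul_of_nonneg_left (hC n ω) (abs_nonneg r)
      · refine (hU.differentiable.continuous.tendsto _).comp ?_
        simpa using ((hD ω).const_mul r).const_add (X₀ ω)
    have hbound : ∀ r : ℝ, ∀ n, ∫ ω, U (X₀ ω + r * D n ω) ∂P ≤ u + r * l (D n) := fun r n => by
      have := hmaj (X₀ + r • D n) (Submodule.add_mem _ ⟨hX₀m, C₀, hC₀⟩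
        (Submodule.smul_mem _ r (hmem n)))
      rw [map_add, map_smul, smul_eq_mul] at this
      simp only [Pi.add_apply, Pi.smul_apply, smul_eq_mul] at this
      linarith
    set I := ∫ ω, U (X₀ ω) ∂P
    have hI : I ≤ u := by
      have := hmaj X₀ ⟨hX₀m, C₀, hC₀⟩
      linarith
    rw [Metric.tendsto_atTop']
    intro ε hε
    -- For large `n` the utilities at `r = ±m` exceed `I - 1`, so `m |l (D n)| < u - I + 1 = m ε`.
    -- The `+ 1` keeps `m` positive when `I = u`.
    set m := (u - I + 1) / ε with hm
    have hmpos : 0 < m := div_pos (by linarith) hε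
    have hev : ∀ r : ℝ, ∀ᶠ n in atTop, I - 1 < u + r * l (D n) := fun r =>
      ((hlim r).eventually_const_lt (sub_one_lt I)).mono fun n hn => hn.trans_le (hbound r n)
    obtain ⟨n₀, hn₀⟩ := eventually_atTop.1 ((hev m).and (hev (-m)))
    refine ⟨n₀, fun n hn => ?_⟩
    obtain ⟨h1, h2⟩ := hn₀ n hn.le
    have hme : m * ε = u - I + 1 := by rw [hm]; field_simp
    rw [Real.dist_eq, sub_zero, abs_lt]
    constructor <;> nlinarith
  obtain ⟨ν, hνfin, hνw, hν⟩ := exists_measure_of_linear hwm hw l hpos hcont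
  refine ⟨ν, hνfin, ?_, hνw, fun g hg => by rw [← hν g (hG hg)]; exact hlG g hg, fun X hX => ?_⟩
  · refine Measure.AbsolutelyContinuous.mk fun A hA hPA => ?_
    have hmem := growthSpace_of_bounded hw (measurable_indicator_one hA) (abs_indicator_one_le A)
    have key : ∀ r : ℝ, ∫ ω, U (X₀ ω) ∂P ≤ u + r * ν.real A := fun r => by
      have h1 := hmaj (X₀ + r • A.indicator (1 : Ω → ℝ)) (Submodule.add_mem _ hX₀
        (Submodule.smul_mem _ r hmem))
      rw [map_add, map_smul, smul_eq_mul, hν _ hmem, integral_indicator_one hA] at h1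
      have h2 : ∫ ω, U ((X₀ + r • A.indicator (1 : Ω → ℝ)) ω) ∂P = ∫ ω, U (X₀ ω) ∂P := by
        refine integral_congr_ae ?_
        filter_upwards [measure_eq_zero_iff_ae_notMem.1 hPA] with ω hω
        simp [hω]
      linarith
    by_contra hne
    have hA0 : 0 < ν.real A := ENNReal.toReal_pos hne (measure_ne_top ν A)
    have := key (-((u - ∫ ω, U (X₀ ω) ∂P + 1) / ν.real A))
    rw [neg_mul, div_mul_cancel₀ _ hA0.ne'] at this
    linarith
  · rw [← hν X hX, ← hν X₀ hX₀]
    exact hmaj X hX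

/-- The conjugate of the expected utility is dominated by its value on bounded positions. -/
theorem eexp_conj_le [IsProbabilityMeasure P] (hU : IsInadaUtility U) {ν : Measure Ω}
    [IsFiniteMeasure ν] (hνP : ν ≪ P) {c : ℝ}
    (h : ∀ X : Ω → ℝ, Measurable X → (∃ C, ∀ ω, |X ω| ≤ C) →
      ∫ ω, U (X ω) ∂P - ∫ ω, X ω ∂ν ≤ c) :
    eexp P (fun ω => conj U (ν.rnDeriv P ω).toReal) ≤ c := by
  have hcont := hU.differentiable.continuous
  set Z : Ω → ℝ := fun ω => (ν.rnDeriv P ω).toReal with hZ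
  have hZm : Measurable Z := (Measure.measurable_rnDeriv ν P).ennreal_toReal
  obtain ⟨q, hq⟩ := exists_surjective_nat ℚ
  obtain ⟨k₀, hk₀⟩ := hq 0
  have hlow : ∀ y, ((U 0 : ℝ) : EReal) ≤ conj U y := fun y => by simpa using le_conj U 0 y
  rw [eexp_eq_lintegral_sub_add (f := fun ω => conj U (Z ω)) ((measurable_conj hcont).comp hZm)
    fun ω => hlow _]
  let f : ℕ → Ω → ℝ≥0∞ := fun k ω => ENNReal.ofReal (U (q k) - q k * Z ω - U 0)
  have hfm : ∀ k, Measurable (f k) := fun k =>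
    ENNReal.measurable_ofReal.comp (by fun_prop)
  have hsup : ∀ ω, (conj U (Z ω) - (U 0 : ℝ)).toENNReal ≤ ⨆ n, partialSups f n ω := fun ω => by
    rw [← EReal.toENNReal_coe (x := ⨆ n, partialSups f n ω)]
    refine EReal.toENNReal_le_toENNReal ?_
    refine EReal.sub_le_iff_le_add (by simp) (by simp) |>.2 ?_
    rw [conj_eq_iSup_rat hcont]
    refine iSup_le fun r => ?_
    obtain ⟨k, rfl⟩ := hq r
    have h1 : f k ω ≤ ⨆ n, partialSups f n ω :=
      (le_partialSups f k ω).trans (le_iSup (fun n => partialSups f n ω) k)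
    calc ((U (q k) - q k * Z ω : ℝ) : EReal)
        = ((U (q k) - q k * Z ω - U 0 : ℝ) : EReal) + ((U 0 : ℝ) : EReal) := by
          rw [← EReal.coe_add, sub_add_cancel]
      _ ≤ ((f k ω : ℝ≥0∞) : EReal) + ((U 0 : ℝ) : EReal) := by
          gcongr
          rw [EReal.coe_ennreal_ofReal]
          exact EReal.coe_le_coe_iff.2 (le_max_left _ _)
      _ ≤ _ := by
          gcongr
          exact_mod_cast h1
  have hn : ∀ n, ∫⁻ ω, partialSups f n ω ∂P ≤ ENNReal.ofReal (c - U 0) := fun n => by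
    -- Including the index `k₀` of the rational `0` makes the maximiser do at least as well as `U
    -- 0`, so the integrand below is nonnegative.
    obtain ⟨X, hXm, ⟨s, hs⟩, hUXm, hX⟩ := exists_measurable_maximiser U hZm
      (fun k => (q k : ℝ)) (max n k₀)
    have hC : ∀ ω, |X ω| ≤ ∑ x ∈ s, |x| := fun ω =>
      Finset.single_le_sum (f := fun x => |x|) (fun _ _ => abs_nonneg _) (hs ω)
    have hXν : Integrable X ν := .of_bound hXm.aestronglyMeasurable _ (.of_forall hC)
    have hUX : Integrable (fun ω => U (X ω)) P := by
      refine .of_bound hUXm.aestronglyMeasurable (∑ x ∈ s, |U x|)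
        (.of_forall fun ω => ?_)
      exact Finset.single_le_sum (f := fun x => |U x|) (fun _ _ => abs_nonneg _) (hs ω)
    have hZX : Integrable (fun ω => Z ω * X ω) P := (integrable_toReal_rnDeriv_mul_iff hνP).2 hXν
    have hnn : ∀ ω, 0 ≤ U (X ω) - Z ω * X ω - U 0 := fun ω => by
      have := hX ω k₀ (le_max_right _ _)
      rw [hk₀] at this
      simp only [Rat.cast_zero, zero_mul, sub_zero] at this
      linarith
    calc ∫⁻ ω, partialSups f n ω ∂P
        ≤ ∫⁻ ω, ENNReal.ofReal (U (X ω) - Z ω * X ω - U 0) ∂P := by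
          refine lintegral_mono fun ω => partialSups_le f n
            (fun ω => ENNReal.ofReal (U (X ω) - Z ω * X ω - U 0)) (fun k hk ω => ?_) ω
          refine ENNReal.ofReal_le_ofReal ?_
          have := hX ω k (hk.trans (le_max_left _ _))
          rw [mul_comm (Z ω)]
          linarith
      _ = ENNReal.ofReal (∫ ω, (U (X ω) - Z ω * X ω - U 0) ∂P) :=
          (ofReal_integral_eq_lintegral_ofReal ((hUX.sub hZX).sub (integrable_const _))
            (.of_forall hnn)).symm
      _ ≤ ENNReal.ofReal (c - U 0) := by
          refine ENNReal.ofReal_le_ofReal ?_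
          have h1 : ∫ ω, (U (X ω) - Z ω * X ω - U 0) ∂P
              = ∫ ω, U (X ω) ∂P - ∫ ω, X ω ∂ν - U 0 := by
            have hd : Integrable (fun ω => U (X ω) - Z ω * X ω) P := hUX.sub hZX
            rw [integral_sub hd (integrable_const _), integral_sub hUX hZX,
              integral_toReal_rnDeriv_mul hνP]
            simp
          rw [h1]
          linarith [h X hXm ⟨_, hC⟩]
  have hle : ∫⁻ ω, (conj U (Z ω) - (U 0 : ℝ)).toENNReal ∂P ≤ ENNReal.ofReal (c - U 0) := by
    refine (lintegral_mono hsup).trans ?_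
    rw [lintegral_iSup]
    · exact iSup_le hn
    · intro n
      induction n with
      | zero => rw [partialSups_zero]; exact hfm 0
      | succ n ih => rw [partialSups_add_one]; exact ih.sup (hfm _)
    · exact fun m n hmn ω => partialSups_monotone f hmn ω
  have hc : U 0 ≤ c := by
    simpa using h 0 measurable_const ⟨0, fun ω => by simp⟩
  calc _ ≤ ((ENNReal.ofReal (c - U 0) : ℝ≥0∞) : EReal) + ((U 0 : ℝ) : EReal) := by
        gcongr
        exact_mod_cast hle
    _ = c := by
        rw [EReal.coe_ennreal_ofReal, max_eq_left (by linarith), ← EReal.coe_add]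
        simp

end FixedModel

/-! ### Bounded utilities: the conjugate near zero -/

section BoundedUtility

variable {U : ℝ → ℝ} {u : ℝ}

/-- For `x ≥ 0` the bound `u` suffices; for `x ≤ 0` a tangent of slope at least `z` does. -/
theorem conj_ne_top_of_le (hU : IsInadaUtility U) (hu : ∀ x, U x ≤ u) {z : ℝ} (hz : 0 ≤ z) :
    conj U z ≠ ⊤ := by
  obtain ⟨x₁, hx₁⟩ := (hU.deriv_atBot.eventually_ge_atTop z).exists
  refine ne_top_of_le_ne_top (EReal.coe_ne_top (max u (U x₁ - deriv U x₁ * x₁)))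
    (iSup_le fun x => EReal.coe_le_coe_iff.2 ?_)
  rcases le_total 0 x with hx | hx
  · exact le_max_of_le_left (by have := mul_nonneg hx hz; linarith [hu x])
  · refine le_max_of_le_right ?_
    have h1 := hU.le_tangent x₁ x
    have h2 := mul_le_mul_of_nonpos_right hx₁ hx
    linarith

/-- If `U` is bounded by `u`, the slope of its conjugate at zero is `-∞`, so that a nonzero measure
of finite divergence bounds attainable utilities away from `u`. -/
theorem exists_lt_integral_utility_le (hU : IsInadaUtility U) (hu : ∀ x, U x ≤ u)
    {Ω : Type*} [MeasurableSpace Ω] {P ν : Measure Ω} [IsProbabilityMeasure P] [IsFiniteMeasure ν]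
    (hνP : ν ≪ P) (hν : ν ≠ 0) (hfin : eexp P (fun ω => conj U (ν.rnDeriv P ω).toReal) ≠ ⊤)
    (c : ℝ) : ∃ v < u, ∀ X : Ω → ℝ, Integrable (fun ω => U (X ω)) P → Integrable X ν →
      ∫ ω, X ω ∂ν = c → ∫ ω, U (X ω) ∂P ≤ v := by
  set Z : Ω → ℝ := fun ω => (ν.rnDeriv P ω).toReal with hZdef
  have hZ0 : ∀ ω, 0 ≤ Z ω := fun ω => ENNReal.toReal_nonneg
  have hZm : Measurable Z := (Measure.measurable_rnDeriv ν P).ennreal_toReal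
  set V : ℝ → ℝ := fun z => (conj U z).toReal with hVdef
  have hcont := hU.differentiable.continuous
  have hVm : Measurable V := (measurable_conj hcont).ereal_toReal
  have hV : ∀ z, 0 ≤ z → ((V z : ℝ) : EReal) = conj U z := fun z hz =>
    EReal.coe_toReal (conj_ne_top_of_le hU hu hz)
      (ne_bot_of_le_ne_bot (EReal.coe_ne_bot _) (le_conj U 0 z))
  have hleV : ∀ z, 0 ≤ z → ∀ x, U x - x * z ≤ V z := fun z hz x => by
    have := le_conj U x z
    rwa [← hV z hz, EReal.coe_le_coe_iff] at this
  have hVle : ∀ z, 0 ≤ z → ∀ r, (∀ x, U x - x * z ≤ r) → V z ≤ r := fun z hz r hr => by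
    rw [← EReal.coe_le_coe_iff, hV z hz]
    exact iSup_le fun x => EReal.coe_le_coe_iff.2 (hr x)
  have hV0 : ∀ z, 0 ≤ z → U 0 ≤ V z := fun z hz => by simpa using hleV z hz 0
  have hsplit : ∀ (n : ℕ) (z : ℝ) (x : ℝ), (n + 1 : ℝ) * (U x - x * (z / (n + 1)))
      = U x - x * z + n * U x := fun n z x => by
    field_simp
    ring
  have hn0 : ∀ n : ℕ, (0 : ℝ) < n + 1 := fun n => by positivity
  -- Convexity of `V` between `0` and `z`, with `V 0` bounded by `u`.
  have hconv : ∀ (n : ℕ) (z : ℝ), 0 ≤ z → (n + 1) * V (z / (n + 1)) ≤ V z + n * u := fun n z hz => by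
    rw [← le_div_iff₀' (hn0 n)]
    refine hVle _ (div_nonneg hz (hn0 n).le) _ fun x => ?_
    rw [le_div_iff₀' (hn0 n), hsplit]
    exact add_le_add (hleV z hz x) (mul_le_mul_of_nonneg_left (hu x) n.cast_nonneg)
  have hVint : Integrable (fun ω => V (Z ω)) P := by
    have h1 : eexp P (fun ω => ((V (Z ω) : ℝ) : EReal)) ≠ ⊤ := by
      simp only [hV _ (hZ0 _)]
      exact hfin
    rw [eexp_eq_lintegral_sub_add (f := fun ω => ((V (Z ω) : ℝ) : EReal))
      (measurable_coe_real_ereal.comp (hVm.comp hZm)) fun ω => EReal.coe_le_coe_iff.2 (hV0 _ (hZ0 ω))] at h1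
    simp only [← EReal.coe_sub, EReal.real_coe_toENNReal] at h1
    have h2 : ∫⁻ ω, ENNReal.ofReal (V (Z ω) - U 0) ∂P ≠ ⊤ := fun h => by
      rw [h] at h1
      simp at h1
    have h3 : Integrable (fun ω => V (Z ω) - U 0) P :=
      ((lintegral_ofReal_ne_top_iff_integrable ((hVm.comp hZm).sub_const _).aestronglyMeasurable
        (.of_forall fun ω => sub_nonneg.2 (hV0 _ (hZ0 ω)))).1 h2)
    exact (h3.add (integrable_const (U 0))).congr (.of_forall fun ω => by simp)
  have hVnint : ∀ n : ℕ, Integrable (fun ω => V (Z ω / (n + 1))) P := fun n => by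
    refine Integrable.mono' ((hVint.abs.add (integrable_const (n * |u|))).add
      (integrable_const |U 0|)) (hVm.comp (hZm.div_const _)).aestronglyMeasurable
      (.of_forall fun ω => ?_)
    have h1 := hconv n _ (hZ0 ω)
    have h2 := hV0 _ (div_nonneg (hZ0 ω) (hn0 n).le)
    have h3 : (n : ℝ) * u ≤ n * |u| := mul_le_mul_of_nonneg_left (le_abs_self u) n.cast_nonneg
    have h4 := le_abs_self (V (Z ω))
    have h5 := neg_abs_le (U 0)
    have h6 : (0 : ℝ) ≤ n * |u| := by positivity
    simp only [Pi.add_apply, Real.norm_eq_abs]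
    refine abs_le.2 ⟨by linarith [abs_nonneg (V (Z ω))], ?_⟩
    by_cases h7 : 0 ≤ V (Z ω / (n + 1))
    · have : V (Z ω / (n + 1)) ≤ (n + 1) * V (Z ω / (n + 1)) :=
        le_mul_of_one_le_left h7 (by linarith [n.cast_nonneg (α := ℝ)])
      linarith [abs_nonneg (U 0)]
    · linarith [abs_nonneg (U 0), abs_nonneg (V (Z ω))]
  by_contra! hcon
  -- Fenchel's inequality against `ν / (n + 1)`, applied to positions whose utility approaches `u`.
  have hlow : ∀ n : ℕ, u ≤ ∫ ω, V (Z ω / (n + 1)) ∂P + c / (n + 1) := fun n => by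
    by_contra! hlt
    obtain ⟨X, hUX, hX, hXc, hXlt⟩ := hcon _ hlt
    have hZX : Integrable (fun ω => Z ω * X ω) P := (integrable_toReal_rnDeriv_mul_iff hνP).2 hX
    have : ∫ ω, U (X ω) ∂P ≤ ∫ ω, (V (Z ω / (n + 1)) + Z ω * X ω / (n + 1)) ∂P := by
      refine integral_mono hUX ((hVnint n).add (hZX.div_const _)) fun ω => ?_
      have := hleV _ (div_nonneg (hZ0 ω) (hn0 n).le) (X ω)
      have h2 : X ω * (Z ω / (n + 1)) = Z ω * X ω / (n + 1) := by ring
      dsimp only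
      linarith
    rw [integral_add (hVnint n) (hZX.div_const _), integral_div, integral_toReal_rnDeriv_mul hνP,
      hXc] at this
    linarith
  -- A rescaled difference quotient of `V` at zero: nonnegative by convexity, of integral bounded in
  -- `n` by `hlow`, yet divergent wherever `Z > 0`. Fatou then forces `Z = 0` almost everywhere.
  let g : ℕ → Ω → ℝ := fun n ω => V (Z ω) - u - (n + 1) * (V (Z ω / (n + 1)) - u)
  have hgm : ∀ n, Measurable (g n) := fun n =>
    ((hVm.comp hZm).sub_const _).sub (((hVm.comp (hZm.div_const _)).sub_const _).const_mul _)
  have hg0 : ∀ n ω, 0 ≤ g n ω := fun n ω => by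
    have := hconv n _ (hZ0 ω)
    simp only [g]
    linarith
  have hgint : ∀ n, ∫⁻ ω, ENNReal.ofReal (g n ω) ∂P
      ≤ ENNReal.ofReal (∫ ω, V (Z ω) ∂P - u + c) := fun n => by
    have hi1 : Integrable (fun ω => V (Z ω) - u) P := hVint.sub (integrable_const _)
    have hi2 : Integrable (fun ω => V (Z ω / (n + 1)) - u) P := (hVnint n).sub (integrable_const _)
    have hgi : Integrable (g n) P := hi1.sub (hi2.const_mul _)
    rw [← ofReal_integral_eq_lintegral_ofReal hgi (.of_forall (hg0 n))]
    refine ENNReal.ofReal_le_ofReal ?_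
    simp only [g]
    rw [integral_sub hi1 (hi2.const_mul _), integral_const_mul, integral_sub hVint
      (integrable_const _), integral_sub (hVnint n) (integrable_const _)]
    simp only [integral_const, probReal_univ, one_smul]
    have h1 := mul_le_mul_of_nonneg_left (hlow n) (hn0 n).le
    have h2 : (n + 1 : ℝ) * (c / (n + 1)) = c := by field_simp
    rw [mul_add, h2] at h1
    linarith
  have hfatou : ∫⁻ ω, liminf (fun n => ENNReal.ofReal (g n ω)) atTop ∂P ≠ ⊤ := by
    refine ne_top_of_le_ne_top (ENNReal.ofReal_ne_top (r := ∫ ω, V (Z ω) ∂P - u + c)) ?_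
    refine (lintegral_liminf_le fun n => (hgm n).ennreal_ofReal).trans ?_
    refine (liminf_le_liminf (.of_forall hgint)).trans ?_
    rw [liminf_const]
  have hae := ae_lt_top (Measurable.liminf fun n => (hgm n).ennreal_ofReal) hfatou
  have hZae : ∀ᵐ ω ∂P, Z ω = 0 := by
    filter_upwards [hae] with ω hω
    by_contra hne
    have hzpos : 0 < Z ω := (hZ0 ω).lt_of_ne (Ne.symm hne)
    refine hω.ne ?_
    have htend : Tendsto (fun n => g n ω) atTop atTop := by
      refine tendsto_atTop.2 fun K => ?_
      -- Trial points `x ≥ k` are penalised by `x Z ≥ K - V(Z) + u`; for `x ≤ k` the gap `u - U k >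
      -- 0`, counted `n` times, exceeds `K`.
      set k := (K - V (Z ω) + u) / Z ω with hk
      have hkz : k * Z ω = K - V (Z ω) + u := div_mul_cancel₀ _ hne
      have hη : 0 < u - U k := by
        have := hU.strictMono (lt_add_one k)
        linarith [hu (k + 1)]
      obtain ⟨m, hm⟩ := exists_nat_gt (K / (u - U k))
      filter_upwards [eventually_ge_atTop m] with n hn
      have hK : K ≤ n * (u - U k) := by
        rw [div_lt_iff₀ hη] at hm
        exact hm.le.trans (mul_le_mul_of_nonneg_right (by exact_mod_cast hn) hη.le)
      have : (n + 1) * V (Z ω / (n + 1)) ≤ (V (Z ω) - u - K) + (n + 1) * u := by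
        rw [← le_div_iff₀' (hn0 n)]
        refine hVle _ (div_nonneg (hZ0 ω) (hn0 n).le) _ fun x => ?_
        rw [le_div_iff₀' (hn0 n)]
        rcases le_total k x with hx | hx
        · have h1 : (n + 1 : ℝ) * (U x - x * (Z ω / (n + 1))) = (n + 1) * U x - x * Z ω := by
            field_simp
          have h2 := mul_le_mul_of_nonneg_left (hu x) (hn0 n).le
          have h3 := mul_le_mul_of_nonneg_right hx (hZ0 ω)
          linarith
        · rw [hsplit]
          have h1 := hleV _ (hZ0 ω) x
          have h2 : (n : ℝ) * U x ≤ n * U k :=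
            mul_le_mul_of_nonneg_left (hU.strictMono.monotone hx) n.cast_nonneg
          linarith
      simp only [g]
      linarith
    exact (ENNReal.tendsto_ofReal_atTop.comp htend).liminf_eq
  refine hν (Measure.measure_univ_eq_zero.1 ?_)
  rw [← Measure.lintegral_rnDeriv hνP]
  refine (lintegral_eq_zero_iff (Measure.measurable_rnDeriv ν P)).2 ?_
  filter_upwards [hZae, Measure.rnDeriv_lt_top ν P] with ω hω hlt
  exact ((ENNReal.toReal_eq_zero_iff _).1 hω).resolve_right hlt.ne

end BoundedUtility

/-! ### Weak lower semicontinuity of expectations -/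

section Semicontinuity

/-- The expectation of a nonnegative lower semicontinuous function is lower semicontinuous for the
weak topology. -/
theorem lowerSemicontinuous_lintegral_ofReal {Ω : Type*} [MeasurableSpace Ω] [TopologicalSpace Ω]
    [OpensMeasurableSpace Ω] [HasOuterApproxClosed Ω] [FirstCountableTopology (ProbabilityMeasure Ω)]
    {g : Ω → ℝ} (hg : LowerSemicontinuous g) (hg0 : 0 ≤ g) :
    LowerSemicontinuous fun P : ProbabilityMeasure Ω =>
      ∫⁻ ω, ENNReal.ofReal (g ω) ∂(P : Measure Ω) := by
  intro P c hc
  by_contra hnot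
  obtain ⟨Q, hQ, hQc⟩ := exists_seq_forall_of_frequently (not_eventually.1 hnot)
  refine hc.not_ge ?_
  have hopen : ∀ t, IsOpen {ω | t < g ω} := fun t => hg.isOpen_preimage t
  -- The layer-cake formula reduces the claim to open superlevel sets, where the portmanteau theorem
  -- applies; Fatou in `t` reassembles them.
  have hm : ∀ R : ProbabilityMeasure Ω, ∫⁻ ω, ENNReal.ofReal (g ω) ∂(R : Measure Ω)
      = ∫⁻ t in Ioi 0, (R : Measure Ω) {ω | t < g ω} := fun R =>
    lintegral_eq_lintegral_meas_lt _ (.of_forall hg0) hg.measurable.aemeasurable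
  calc ∫⁻ ω, ENNReal.ofReal (g ω) ∂(P : Measure Ω)
      = ∫⁻ t in Ioi 0, (P : Measure Ω) {ω | t < g ω} := hm P
    _ ≤ ∫⁻ t in Ioi 0, liminf (fun n => (Q n : Measure Ω) {ω | t < g ω}) atTop :=
        lintegral_mono fun t => ProbabilityMeasure.le_liminf_measure_open_of_tendsto hQ (hopen t)
    _ ≤ liminf (fun n => ∫⁻ t in Ioi 0, (Q n : Measure Ω) {ω | t < g ω}) atTop :=
        lintegral_liminf_le fun n => Antitone.measurable fun s t hst =>
          measure_mono fun ω (hω : t < g ω) => hst.trans_lt hω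
    _ ≤ liminf (fun _ => c) (atTop : Filter ℕ) := by
        refine liminf_le_liminf (.of_forall fun n => ?_)
        rw [← hm]
        exact not_lt.1 (hQc n)
    _ = c := liminf_const c

/-- Lower semicontinuity of expectations, for functions with uniformly integrable negative part. -/
theorem lowerSemicontinuousOn_integral {Ω : Type*} [MeasurableSpace Ω] [TopologicalSpace Ω]
    [OpensMeasurableSpace Ω] [HasOuterApproxClosed Ω] [FirstCountableTopology (ProbabilityMeasure Ω)]
    {K : Set (ProbabilityMeasure Ω)} {h : Ω → ℝ} (hh : LowerSemicontinuous h)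
    (hint : ∀ P ∈ K, Integrable h (P : Measure Ω))
    (htail : ∀ ε > 0, ∃ n : ℝ, ∀ P ∈ K,
      ∫⁻ ω, ENNReal.ofReal (-h ω - n) ∂(P : Measure Ω) ≤ ENNReal.ofReal ε) :
    LowerSemicontinuousOn (fun P : ProbabilityMeasure Ω => ∫ ω, h ω ∂(P : Measure Ω)) K := by
  have hsplit : ∀ n : ℝ, ∀ P ∈ K, ∫ ω, h ω ∂(P : Measure Ω)
      = (∫⁻ ω, ENNReal.ofReal (max (h ω + n) 0) ∂(P : Measure Ω)).toReal - n
        - (∫⁻ ω, ENNReal.ofReal (-h ω - n) ∂(P : Measure Ω)).toReal := fun n P hP => by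
    have h1 : Integrable (fun ω => h ω + n) (P : Measure Ω) :=
      (hint P hP).add (integrable_const n)
    have h2 := integral_eq_lintegral_pos_part_sub_lintegral_neg_part h1
    rw [integral_add (hint P hP) (integrable_const n)] at h2
    simp only [integral_const, probReal_univ, one_smul, neg_add'] at h2
    simp only [ofReal_max_zero]
    linarith
  intro P hP c hc
  dsimp only at hc
  set ε := (∫ ω, h ω ∂(P : Measure Ω) - c) / 2 with hε
  have hεpos : 0 < ε := by linarith
  obtain ⟨n, hn0, hn⟩ : ∃ n : ℝ, 0 ≤ c + n + ε ∧ ∀ Q ∈ K,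
      ∫⁻ ω, ENNReal.ofReal (-h ω - n) ∂(Q : Measure Ω) ≤ ENNReal.ofReal ε := by
    obtain ⟨n, hn⟩ := htail ε hεpos
    -- Raising `n` preserves the tail bound and makes `c + n + ε` nonnegative, so that passing to
    -- `ENNReal.ofReal` loses nothing.
    refine ⟨max n (-(c + ε)), by linarith [le_max_right n (-(c + ε))], fun Q hQ =>
      (lintegral_mono fun ω => ENNReal.ofReal_le_ofReal ?_).trans (hn Q hQ)⟩
    exact sub_le_sub_left (le_max_left _ _) _
  have hfin : ∀ Q ∈ K, ∫⁻ ω, ENNReal.ofReal (max (h ω + n) 0) ∂(Q : Measure Ω) ≠ ⊤ :=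
    fun Q hQ => ((hint Q hQ).add (integrable_const n)).pos_part.lintegral_lt_top.ne
  have hlsc : LowerSemicontinuous fun ω => max (h ω + n) 0 :=
    ((continuous_id.add continuous_const).max continuous_const).comp_lowerSemicontinuous hh
      fun a b hab => max_le_max (by simpa using hab) le_rfl
  have key := lowerSemicontinuous_lintegral_ofReal hlsc (fun ω => le_max_right _ _) P
    (ENNReal.ofReal (c + n + ε)) (by
      change ENNReal.ofReal (c + n + ε) < _
      rw [ENNReal.ofReal_lt_iff_lt_toReal hn0 (hfin P hP)]
      have := hsplit n P hP
      have := ENNReal.toReal_nonneg (a := ∫⁻ ω, ENNReal.ofReal (-h ω - n) ∂(P : Measure Ω))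
      linarith)
  filter_upwards [self_mem_nhdsWithin, mem_nhdsWithin_of_mem_nhds key] with Q hQ hQlt
  rw [gt_iff_lt, ENNReal.ofReal_lt_iff_lt_toReal hn0 (hfin Q hQ)] at hQlt
  have := ENNReal.toReal_le_of_le_ofReal hεpos.le (hn Q hQ)
  rw [hsplit n Q hQ]
  linarith

end Semicontinuity

/-! ### Uniform integrability of losses of linear growth -/

section UniformIntegrability

variable {N : ℕ} {U : ℝ → ℝ} {Pfam : Set (ProbabilityMeasure (Path N))}

/-- The weight `1 + ∑ᵢ |S_i|`. -/
def weight {N : ℕ} (ω : Path N) : ℝ := 1 + ∑ i, |ω i|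

theorem one_le_weight (ω : Path N) : 1 ≤ weight ω :=
  le_add_of_nonneg_right (Finset.sum_nonneg fun _ _ => abs_nonneg _)

theorem abs_le_weight (ω : Path N) (i : Fin N) : |ω i| ≤ weight ω :=
  (Finset.single_le_sum (f := fun i => |ω i|) (fun _ _ => abs_nonneg _) (Finset.mem_univ i)).trans
    (le_add_of_nonneg_left zero_le_one)

theorem continuous_weight : Continuous (weight (N := N)) := by
  unfold weight
  fun_prop

/-- Losses of size proportional to the weight are controlled by losses in single coordinates. -/
theorem neg_utility_weight_le (hU : IsInadaUtility U) {C : ℝ} (hC : 0 ≤ C) (ω : Path N) :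
    ENNReal.ofReal (-U (-(C * weight ω))) ≤ ENNReal.ofReal (-U (-(C * (N + 1)))) +
      ∑ i, ENNReal.ofReal (-U (-(C * (N + 1) * |ω i|))) := by
  -- Of the `N + 1` summands of the weight, the largest is at least their mean.
  have hex : weight ω ≤ N + 1 ∨ ∃ i, weight ω ≤ (N + 1) * |ω i| := by
    by_contra! hcon
    obtain ⟨h1, h2⟩ := hcon
    have h3 : ∑ i : Fin N, ((N : ℝ) + 1) * |ω i| ≤ ∑ i : Fin N, weight ω :=
      Finset.sum_le_sum fun i _ => (h2 i).le
    rw [← Finset.mul_sum, Finset.sum_const, Finset.card_univ, Fintype.card_fin, nsmul_eq_mul] at h3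
    have h4 : weight ω = 1 + ∑ i, |ω i| := rfl
    nlinarith
  rcases hex with h | ⟨i, h⟩
  · refine le_add_right (ENNReal.ofReal_le_ofReal (neg_le_neg (hU.strictMono.monotone ?_)))
    exact neg_le_neg (mul_le_mul_of_nonneg_left h hC)
  · refine le_add_left (le_trans (ENNReal.ofReal_le_ofReal
      (neg_le_neg (hU.strictMono.monotone ?_))) (Finset.single_le_sum
        (f := fun i => ENNReal.ofReal (-U (-(C * (N + 1) * |ω i|)))) (fun _ _ => zero_le)
        (Finset.mem_univ i)))
    rw [mul_assoc]
    exact neg_le_neg (mul_le_mul_of_nonneg_left h hC)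

/-- Uniform integrability over the family of the losses proportional to the weight. -/
theorem exists_uniform_tail (hU : IsInadaUtility U) (hUI : UniformlyIntegrableLosses U Pfam)
    {C : ℝ} (hC : 0 < C) {ε : ℝ} (hε : 0 < ε) : ∃ n : ℝ, 0 ≤ n ∧ ∀ P ∈ Pfam,
      ∫⁻ ω, ENNReal.ofReal (-U (-(C * weight ω)) - n) ∂(P : Measure (Path N)) ≤
        ENNReal.ofReal ε := by
  set α : ℝ := C * (N + 1) with hα
  have hαpos : 0 < α := by positivity
  have hδ : 0 < ENNReal.ofReal (ε / (N + 1)) := ENNReal.ofReal_pos.2 (by positivity)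
  have hev : ∀ᶠ m : ℕ in atTop, ∀ i : Fin N, ⨆ P ∈ Pfam, ∫⁻ ω in {ω : Path N | (m : ℝ) < |ω i|},
      ENNReal.ofReal (-U (-(α * |ω i|))) ∂(P : Measure (Path N)) < ENNReal.ofReal (ε / (N + 1)) :=
    eventually_all.2 fun i => (hUI i α hαpos).eventually_lt_const hδ
  obtain ⟨m, hm⟩ := hev.exists
  -- This level absorbs the constant term and the losses of all coordinates with `|ω i| ≤ m`; the
  -- excess is carried by the sets `{|ω i| > m}`.
  set a : ℝ := max (-U (-α)) 0 + N * max (-U (-(α * m))) 0 with ha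
  refine ⟨a, by positivity, fun P hP => ?_⟩
  have hmeas : ∀ i : Fin N, MeasurableSet {ω : Path N | (m : ℝ) < |ω i|} := fun i =>
    measurableSet_lt measurable_const (measurable_pi_apply i).abs
  have hpt : ∀ ω : Path N, ENNReal.ofReal (-U (-(C * weight ω)) - a) ≤
      ∑ i, {ω : Path N | (m : ℝ) < |ω i|}.indicator
        (fun ω => ENNReal.ofReal (-U (-(α * |ω i|)))) ω := fun ω => by
    rw [ENNReal.ofReal_sub _ (by positivity), tsub_le_iff_left]
    refine (neg_utility_weight_le hU hC.le ω).trans ?_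
    rw [ha, ENNReal.ofReal_add (by positivity) (by positivity), ofReal_max_zero, add_assoc,
      ENNReal.ofReal_mul N.cast_nonneg, ofReal_max_zero, ENNReal.ofReal_natCast]
    refine add_le_add le_rfl ?_
    have hc : (N : ℝ≥0∞) * ENNReal.ofReal (-U (-(α * m)))
        = ∑ _i : Fin N, ENNReal.ofReal (-U (-(α * m))) := by simp
    rw [hc, ← Finset.sum_add_distrib]
    refine Finset.sum_le_sum fun i _ => ?_
    by_cases h : (m : ℝ) < |ω i|
    · rw [indicator_of_mem (show ω ∈ {ω : Path N | (m : ℝ) < |ω i|} from h)]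
      exact le_add_left le_rfl
    · refine le_add_right (ENNReal.ofReal_le_ofReal (neg_le_neg (hU.strictMono.monotone ?_)))
      exact neg_le_neg (mul_le_mul_of_nonneg_left (not_lt.1 h) hαpos.le)
  refine (lintegral_mono hpt).trans ?_
  have hUm : Measurable U := hU.differentiable.continuous.measurable
  rw [lintegral_finsetSum _ fun i _ => Measurable.indicator (by fun_prop) (hmeas i)]
  calc _ ≤ ∑ _i : Fin N, ENNReal.ofReal (ε / (N + 1)) := by
        refine Finset.sum_le_sum fun i _ => ?_
        rw [lintegral_indicator (hmeas i)]
        exact (le_iSup₂ (f := fun (P : ProbabilityMeasure (Path N)) (_ : P ∈ Pfam) =>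
          ∫⁻ ω in {ω : Path N | (m : ℝ) < |ω i|},
            ENNReal.ofReal (-U (-(α * |ω i|))) ∂(P : Measure (Path N))) P hP).trans (hm i).le
    _ ≤ ENNReal.ofReal ε := by
        rw [Finset.sum_const, Finset.card_univ, Fintype.card_fin, ← ENNReal.ofReal_nsmul,
          nsmul_eq_mul]
        refine ENNReal.ofReal_le_ofReal ?_
        rw [mul_div_assoc', div_le_iff₀ (by positivity)]
        nlinarith

theorem integrable_neg_part (hU : IsInadaUtility U) (hUI : UniformlyIntegrableLosses U Pfam)
    {P : ProbabilityMeasure (Path N)} (hP : P ∈ Pfam) {C : ℝ} (hC : 0 < C) :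
    Integrable (fun ω : Path N => max (-U (-(C * weight ω))) 0) (P : Measure (Path N)) := by
  obtain ⟨n, -, hn⟩ := exists_uniform_tail hU hUI hC one_pos
  have hUm : Measurable U := hU.differentiable.continuous.measurable
  have hwm : Measurable (weight (N := N)) := continuous_weight.measurable
  refine (lintegral_ofReal_ne_top_iff_integrable
    (f := fun ω : Path N => max (-U (-(C * weight ω))) 0)
    (Measurable.aestronglyMeasurable (by fun_prop)) (.of_forall fun ω => le_max_right _ _)).1 ?_
  simp only [ofReal_max_zero]
  refine ne_top_of_le_ne_top (b := ENNReal.ofReal 1 + ENNReal.ofReal n) (by simp) ?_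
  calc _ ≤ ∫⁻ ω, (ENNReal.ofReal (-U (-(C * weight ω)) - n) + ENNReal.ofReal n)
          ∂(P : Measure (Path N)) := lintegral_mono fun ω => by
        refine (ENNReal.ofReal_le_ofReal ?_).trans ENNReal.ofReal_add_le
        linarith
    _ ≤ _ := by
        rw [lintegral_add_right _ measurable_const]
        simp only [lintegral_const, measure_univ, mul_one]
        exact add_le_add (hn P hP) le_rfl

/-- Because `U' → ∞` at `-∞`, losses dominate the weight up to a constant. -/
theorem integrable_weight (hU : IsInadaUtility U) (hUI : UniformlyIntegrableLosses U Pfam)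
    {P : ProbabilityMeasure (Path N)} (hP : P ∈ Pfam) :
    Integrable weight (P : Measure (Path N)) := by
  obtain ⟨C, hC⟩ := hU.exists_mul_le 1
  have hUm : Measurable U := hU.differentiable.continuous.measurable
  have hwm : Measurable (weight (N := N)) := continuous_weight.measurable
  have h1 := integrable_neg_part hU hUI hP one_pos
  refine (h1.add (integrable_const |C|)).mono' hwm.aestronglyMeasurable (.of_forall fun ω => ?_)
  have h3 := one_le_weight ω
  have h4 := hC (weight ω) (by linarith)
  rw [one_mul] at h4
  simp only [Pi.add_apply, Real.norm_eq_abs, one_mul]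
  rw [abs_of_nonneg (by linarith)]
  linarith [le_abs_self C, le_max_left (-U (-weight ω)) 0]

theorem integrable_utility_weight (hU : IsInadaUtility U)
    (hUI : UniformlyIntegrableLosses U Pfam) {P : ProbabilityMeasure (Path N)} (hP : P ∈ Pfam)
    (C : ℝ) : Integrable (fun ω => U (-(C * weight ω))) (P : Measure (Path N)) := by
  have hUm : Measurable U := hU.differentiable.continuous.measurable
  have hwm : Measurable (weight (N := N)) := continuous_weight.measurable
  set D := |C| + 1 with hD
  have h1 := integrable_neg_part hU hUI hP (show 0 < D by positivity)
  refine ((h1.add (integrable_const |U 0|)).add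
    (((integrable_weight hU hUI hP).const_mul (D)).const_mul (deriv U 0))).mono'
    (Measurable.aestronglyMeasurable (by fun_prop))
    (.of_forall fun ω => ?_)
  have h3 := one_le_weight ω
  have h4 : |C * weight ω| ≤ D * weight ω := by
    rw [abs_mul, abs_of_nonneg (by linarith : 0 ≤ weight ω)]
    exact mul_le_mul_of_nonneg_right (by linarith) (by linarith)
  have h5 := hU.strictMono.monotone (neg_le_neg ((le_abs_self _).trans h4))
  have h6 := hU.le_tangent 0 (-(C * weight ω))
  have h7 := mul_le_mul_of_nonneg_left ((neg_le_abs _).trans h4) (hU.deriv_nonneg 0)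
  have h8 := mul_nonneg (hU.deriv_nonneg 0) ((abs_nonneg _).trans h4)
  rw [sub_zero] at h6
  simp only [Pi.add_apply, Real.norm_eq_abs]
  refine abs_le.2 ⟨?_, ?_⟩
  · linarith [abs_nonneg (U 0), le_max_left (-U (-(D * weight ω))) 0]
  · linarith [le_abs_self (U 0), le_max_right (-U (-(D * weight ω))) 0]

end UniformIntegrability

/-! ### Semistatic gains -/

section Gains

variable {N : ℕ}

/-- The path up to time `t`. -/
def history (t : Fin N) (ω : Path N) : Fin (t : ℕ) → ℝ := fun j => ω (Fin.castLE t.isLt.le j)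

theorem continuous_history (t : Fin N) : Continuous (history t) := by
  unfold history
  fun_prop

theorem continuous_price (s₀ : ℝ) (t : Fin (N + 1)) : Continuous (price (N := N) s₀ t) := by
  refine Fin.cases ?_ (fun i => ?_) t
  · exact continuous_const
  · exact continuous_apply i

theorem price_mem_growthSpace (s₀ : ℝ) (t : Fin (N + 1)) :
    price (N := N) s₀ t ∈ growthSpace weight := by
  refine ⟨price_measurable s₀ t, ?_⟩
  refine Fin.cases ⟨|s₀|, fun ω => ?_⟩ (fun i => ⟨1, fun ω => ?_⟩) t
  · exact le_mul_of_one_le_right (abs_nonneg _) (one_le_weight ω)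
  · rw [one_mul]
    exact abs_le_weight ω i

theorem mul_mem_growthSpace {Ω : Type*} [MeasurableSpace Ω] {w h X : Ω → ℝ} (hh : Measurable h)
    {C : ℝ} (hC : ∀ ω, |h ω| ≤ C) (hX : X ∈ growthSpace w) :
    (fun ω => h ω * X ω) ∈ growthSpace w := by
  obtain ⟨hXm, D, hD⟩ := hX
  refine ⟨hh.mul hXm, C * D, fun ω => ?_⟩
  rw [abs_mul, mul_assoc]
  exact mul_le_mul (hC ω) (hD ω) (abs_nonneg _) ((abs_nonneg _).trans (hC ω))

/-- The gain of a semistatic strategy, as a linear map. -/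
noncomputable def gain (s₀ : ℝ) (μ : Fin N → ProbabilityMeasure ℝ) :
    DynamicStrategy N × (Fin N → (ℝ →ᵇ ℝ)) →ₗ[ℝ] (Path N → ℝ) where
  toFun s ω := dynamicGain s₀ s.1 ω + staticGain μ s.2 ω
  map_add' s s' := by
    ext ω
    have h : ∀ i, ∫ y, (s.2 i y + s'.2 i y) ∂(μ i : Measure ℝ)
        = ∫ y, s.2 i y ∂(μ i : Measure ℝ) + ∫ y, s'.2 i y ∂(μ i : Measure ℝ) := fun i =>
      integral_add ((s.2 i).integrable _) ((s'.2 i).integrable _)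
    simp only [dynamicGain, staticGain, Prod.fst_add, Prod.snd_add, Pi.add_apply,
      BoundedContinuousFunction.coe_add, h, ← Finset.sum_add_distrib]
    exact Finset.sum_congr rfl fun i _ => by ring
  map_smul' a s := by
    ext ω
    have h : ∀ i, ∫ y, a * s.2 i y ∂(μ i : Measure ℝ) = a * ∫ y, s.2 i y ∂(μ i : Measure ℝ) :=
      fun i => integral_const_mul _ _
    simp only [dynamicGain, staticGain, Prod.smul_fst, Prod.smul_snd, Pi.smul_apply,
      BoundedContinuousFunction.coe_smul, smul_eq_mul, h, ← Finset.sum_add_distrib,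
      Finset.mul_sum, RingHom.id_apply]
    exact Finset.sum_congr rfl fun i _ => by ring

theorem gain_apply (s₀ : ℝ) (μ : Fin N → ProbabilityMeasure ℝ) (H : DynamicStrategy N)
    (f : Fin N → (ℝ →ᵇ ℝ)) (ω : Path N) :
    gain s₀ μ (H, f) ω = dynamicGain s₀ H ω + staticGain μ f ω := rfl

theorem continuous_gain (s₀ : ℝ) (μ : Fin N → ProbabilityMeasure ℝ)
    (s : DynamicStrategy N × (Fin N → (ℝ →ᵇ ℝ))) : Continuous (gain s₀ μ s) := by
  refine Continuous.add (continuous_finsetSum _ fun t _ => Continuous.mul ?_ ?_)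
    (continuous_finsetSum _ fun i _ => ?_)
  · exact (s.1 t).continuous.comp (continuous_history t)
  · exact (continuous_price s₀ _).sub (continuous_price s₀ _)
  · exact ((s.2 i).continuous.comp (continuous_apply i)).sub continuous_const

theorem increment_mem_growthSpace (s₀ : ℝ) (t : Fin N) (h : (Fin (t : ℕ) → ℝ) →ᵇ ℝ) :
    (fun ω => h (history t ω) * (price s₀ t.succ ω - price s₀ t.castSucc ω))
      ∈ growthSpace (weight (N := N)) :=
  mul_mem_growthSpace (h.continuous.comp (continuous_history t)).measurable
    (fun _ => h.norm_coe_le_norm _)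
    (Submodule.sub_mem _ (price_mem_growthSpace s₀ _) (price_mem_growthSpace s₀ _))

theorem vanilla_mem_growthSpace (i : Fin N) (f : ℝ →ᵇ ℝ) :
    (fun ω : Path N => f (ω i)) ∈ growthSpace (weight (N := N)) :=
  growthSpace_of_bounded one_le_weight (f.continuous.comp (continuous_apply i)).measurable
    fun _ => f.norm_coe_le_norm _

theorem const_mem_growthSpace (c : ℝ) : (fun _ : Path N => c) ∈ growthSpace (weight (N := N)) :=
  growthSpace_of_bounded one_le_weight measurable_const fun _ => le_rfl

theorem gain_eq_sum (s₀ : ℝ) (μ : Fin N → ProbabilityMeasure ℝ)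
    (s : DynamicStrategy N × (Fin N → (ℝ →ᵇ ℝ))) : gain s₀ μ s =
      ∑ t, ((fun ω => s.1 t (history t ω) * (price s₀ t.succ ω - price s₀ t.castSucc ω)) +
        ((fun ω => s.2 t (ω t)) - fun _ => ∫ y, s.2 t y ∂(μ t : Measure ℝ))) := by
  ext ω
  rw [Finset.sum_apply]
  simp only [Pi.add_apply, Pi.sub_apply, Finset.sum_add_distrib]
  rfl

theorem gain_mem_growthSpace (s₀ : ℝ) (μ : Fin N → ProbabilityMeasure ℝ)
    (s : DynamicStrategy N × (Fin N → (ℝ →ᵇ ℝ))) : gain s₀ μ s ∈ growthSpace weight := by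
  rw [gain_eq_sum]
  exact Submodule.sum_mem _ fun t _ => Submodule.add_mem _ (increment_mem_growthSpace s₀ t _)
    (Submodule.sub_mem _ (vanilla_mem_growthSpace t _) (const_mem_growthSpace _))

end Gains

/-! ### Martingale measures as annihilators of gains -/

section MartingaleMeasures

variable {N : ℕ} {s₀ : ℝ} {μ : Fin N → ProbabilityMeasure ℝ}

theorem measurable_history (t : Fin N) :
    Measurable[priceFiltration N s₀ t.castSucc] (history t) := by
  refine @measurable_pi_lambda _ _ _ (_) _ _ fun j => ?_
  have h1 : Measurable[priceFiltration N s₀ (Fin.castLE t.isLt.le j).succ]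
      (price (N := N) s₀ (Fin.castLE t.isLt.le j).succ) := by
    refine Measurable.mono (comap_measurable _) ?_ le_rfl
    exact le_iSup₂ (f := fun k (_ : k ≤ (Fin.castLE t.isLt.le j).succ) =>
      MeasurableSpace.comap (price (N := N) s₀ k) (borel ℝ)) _ le_rfl
  refine h1.mono ((priceFiltration N s₀).mono ?_) le_rfl
  rw [Fin.le_def]
  simp

theorem priceFiltration_le_comap_history (t : Fin N) :
    (priceFiltration N s₀ t.castSucc : MeasurableSpace (Path N)) ≤
      MeasurableSpace.comap (history t) inferInstance := by
  refine iSup₂_le fun j hj => ?_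
  refine Measurable.comap_le ?_
  revert hj
  refine Fin.cases (fun _ => measurable_const) (fun i hi => ?_) j
  have hit : (i : ℕ) < t := by
    rw [Fin.le_def] at hi
    simpa using hi
  have : price (N := N) s₀ i.succ = (fun p : Fin (t : ℕ) → ℝ => p ⟨i, hit⟩) ∘ history t := rfl
  rw [this]
  exact (measurable_pi_apply _).comp (comap_measurable _)

theorem integrable_weight_of_mem {Q : ProbabilityMeasure (Path N)}
    (hQ : Q ∈ martingaleMeasures s₀ μ) : Integrable weight (Q : Measure (Path N)) :=
  (integrable_const 1).add (integrable_finsetSum _ fun i _ => (hQ.1.integrable i.succ).abs)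

/-- The position pulls out of the conditional expectation of each price increment, which vanishes;
the options vanish by the marginal constraints. -/
theorem integral_gain_eq_zero {Q : ProbabilityMeasure (Path N)}
    (hQ : Q ∈ martingaleMeasures s₀ μ) (s : DynamicStrategy N × (Fin N → (ℝ →ᵇ ℝ))) :
    ∫ ω, gain s₀ μ s ω ∂(Q : Measure (Path N)) = 0 := by
  have hw := integrable_weight_of_mem hQ
  have hi1 := fun t => integrable_of_mem_growthSpace hw (increment_mem_growthSpace s₀ t (s.1 t))
  have hi2 := fun t => integrable_of_mem_growthSpace hw (vanilla_mem_growthSpace t (s.2 t))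
  rw [gain_eq_sum]
  simp only [Finset.sum_apply, Pi.add_apply, Pi.sub_apply]
  have hi : ∀ t ∈ Finset.univ, Integrable (fun ω : Path N =>
      s.1 t (history t ω) * (price s₀ t.succ ω - price s₀ t.castSucc ω) +
        (s.2 t (ω t) - ∫ y, s.2 t y ∂(μ t : Measure ℝ))) (Q : Measure (Path N)) :=
    fun t _ => (hi1 t).add ((hi2 t).sub (integrable_const _))
  rw [integral_finsetSum _ hi]
  refine Finset.sum_eq_zero fun t _ => ?_
  have hs : Integrable (fun ω : Path N => s.2 t (ω t) - ∫ y, s.2 t y ∂(μ t : Measure ℝ))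
    (Q : Measure (Path N)) := (hi2 t).sub (integrable_const _)
  rw [integral_add (hi1 t) hs, integral_sub (hi2 t) (integrable_const _)]
  have h2 : ∫ ω, s.2 t (ω t) ∂(Q : Measure (Path N)) = ∫ y, s.2 t y ∂(μ t : Measure ℝ) := by
    rw [← hQ.2 t, integral_map (measurable_pi_apply t).aemeasurable
      (s.2 t).continuous.measurable.aestronglyMeasurable]
  have h1 : ∫ ω, s.1 t (history t ω) * (price s₀ t.succ ω - price s₀ t.castSucc ω)
      ∂(Q : Measure (Path N)) = 0 := by
    set F := priceFiltration N s₀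
    have hm := F.le t.castSucc
    have hsm : StronglyMeasurable[F t.castSucc] fun ω => s.1 t (history t ω) :=
      ((s.1 t).continuous.measurable.comp (measurable_history t)).stronglyMeasurable
    have hY : Integrable (price s₀ t.succ - price s₀ t.castSucc) (Q : Measure (Path N)) :=
      (hQ.1.integrable _).sub (hQ.1.integrable _)
    have hcond : (Q : Measure (Path N))[price s₀ t.succ - price s₀ t.castSucc | F t.castSucc]
        =ᵐ[(Q : Measure (Path N))] 0 := by
      filter_upwards [condExp_sub (hQ.1.integrable t.succ) (hQ.1.integrable t.castSucc)
        (F t.castSucc), hQ.1.condExp_ae_eq (Fin.castSucc_lt_succ (i := t)).le,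
        hQ.1.condExp_ae_eq (le_refl t.castSucc)] with ω ha hb hc
      rw [ha, Pi.sub_apply, hb, hc, sub_self, Pi.zero_apply]
    have hpull := condExp_mul_of_stronglyMeasurable_left hsm (hi1 t) hY
    rw [← integral_condExp hm]
    refine (integral_congr_ae ?_).trans (integral_zero' _ _)
    refine hpull.trans ?_
    filter_upwards [hcond] with ω hω
    exact mul_eq_zero_of_right _ hω
  rw [h1, h2]
  simp

/-- The positive and negative parts of the increment, as densities, have finite images under
`history`. Bounded continuous test functions identify these images, hence all events of the past are
covered. -/
theorem setIntegral_increment_eq_zero {Q : ProbabilityMeasure (Path N)}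
    (hw : Integrable weight (Q : Measure (Path N))) (t : Fin N)
    (h : ∀ k : (Fin (t : ℕ) → ℝ) →ᵇ ℝ,
      ∫ ω, k (history t ω) * (price s₀ t.succ ω - price s₀ t.castSucc ω)
        ∂(Q : Measure (Path N)) = 0)
    {A : Set (Path N)} (hA : MeasurableSet[priceFiltration N s₀ t.castSucc] A) :
    ∫ ω in A, (price s₀ t.succ ω - price s₀ t.castSucc ω) ∂(Q : Measure (Path N)) = 0 := by
  obtain ⟨B, hB, rfl⟩ := priceFiltration_le_comap_history t A hA
  set Y : Path N → ℝ := fun ω => price s₀ t.succ ω - price s₀ t.castSucc ω with hYdef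
  have hYmem : Y ∈ growthSpace weight :=
    Submodule.sub_mem _ (price_mem_growthSpace s₀ _) (price_mem_growthSpace s₀ _)
  have hY : Integrable Y (Q : Measure (Path N)) := integrable_of_mem_growthSpace hw hYmem
  have hYm := hYmem.1
  have hπ : Measurable (history t) := (continuous_history t).measurable
  let ν : (Path N → ℝ) → Measure (Fin (t : ℕ) → ℝ) := fun X =>
    ((Q : Measure (Path N)).withDensity fun ω => ENNReal.ofReal (X ω)).map (history t)
  have hνfin : ∀ X : Path N → ℝ, Integrable X (Q : Measure (Path N)) → IsFiniteMeasure (ν X) :=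
    fun X hX => by
      have := isFiniteMeasure_withDensity_ofReal hX.2
      infer_instance
  have hfin1 := hνfin _ hY
  have hfin2 := hνfin _ hY.neg
  have hint : ∀ X : Path N → ℝ, Measurable X → ∀ k : (Fin (t : ℕ) → ℝ) →ᵇ ℝ,
      ∫ p, k p ∂(ν X) = ∫ ω, max (X ω) 0 * k (history t ω) ∂(Q : Measure (Path N)) :=
    fun X hX k => by
      rw [integral_map hπ.aemeasurable k.continuous.measurable.aestronglyMeasurable,
        integral_withDensity_eq_integral_toReal_smul hX.ennreal_ofReal (by simp)]
      simp only [ENNReal.toReal_ofReal', smul_eq_mul]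
  have heq : ν Y = ν (-Y) := by
    refine ext_of_forall_integral_eq_of_IsFiniteMeasure fun k => ?_
    rw [hint Y hYm k, hint (-Y) hYm.neg k, ← sub_eq_zero, ← integral_sub]
    · refine (integral_congr_ae (.of_forall fun ω => ?_)).trans (h k)
      have := max_zero_sub_max_neg_zero_eq_self (Y ω)
      simp only [Pi.neg_apply]
      rw [← sub_mul, this, mul_comm]
    · exact hY.pos_part.mul_bdd (k.continuous.measurable.comp hπ).aestronglyMeasurable
        (.of_forall fun ω => k.norm_coe_le_norm _)
    · exact hY.neg_part.mul_bdd (k.continuous.measurable.comp hπ).aestronglyMeasurable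
        (.of_forall fun ω => k.norm_coe_le_norm _)
  have hAm : MeasurableSet (history t ⁻¹' B) := hπ hB
  have hB' := congrArg (fun m => m B) heq
  simp only [ν, Measure.map_apply hπ hB, withDensity_apply _ hAm] at hB'
  rw [integral_eq_lintegral_pos_part_sub_lintegral_neg_part hY.integrableOn, hB']
  simp

/-- Trading in a single period, or holding a single option, isolates each defining constraint;
longer horizons follow by adding one-step increments. -/
theorem mem_martingaleMeasures_of_integral_gain {Q : ProbabilityMeasure (Path N)}
    (hw : Integrable weight (Q : Measure (Path N)))
    (h : ∀ s, ∫ ω, gain s₀ μ s ω ∂(Q : Measure (Path N)) = 0) :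
    Q ∈ martingaleMeasures s₀ μ := by
  classical
  have hpint : ∀ t, Integrable (price s₀ t) (Q : Measure (Path N)) := fun t =>
    integrable_of_mem_growthSpace hw (price_mem_growthSpace s₀ t)
  have hdyn : ∀ (t : Fin N) (k : (Fin (t : ℕ) → ℝ) →ᵇ ℝ),
      ∫ ω, k (history t ω) * (price s₀ t.succ ω - price s₀ t.castSucc ω)
        ∂(Q : Measure (Path N)) = 0 := fun t k => by
    rw [← h (Pi.single t k, 0)]
    refine integral_congr_ae (.of_forall fun ω => ?_)
    rw [gain_apply]
    have h0 : staticGain μ 0 ω = 0 := by simp [staticGain]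
    have h1 : dynamicGain s₀ (Pi.single t k) ω
        = k (history t ω) * (price s₀ t.succ ω - price s₀ t.castSucc ω) := by
      rw [dynamicGain, Finset.sum_eq_single t]
      · rw [Pi.single_eq_same]; rfl
      · intro j _ hj
        rw [Pi.single_eq_of_ne hj]
        simp
      · simp
    rw [h0, h1, add_zero]
  refine ⟨⟨Filtration.stronglyAdapted_natural _, fun i j hij => ?_⟩, fun i => ?_⟩
  · have hset : ∀ k : ℕ, ∀ hk : k < N + 1, (i : ℕ) ≤ k → ∀ A,
        MeasurableSet[priceFiltration N s₀ i] A →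
        ∫ ω in A, price s₀ ⟨k, hk⟩ ω ∂(Q : Measure (Path N))
          = ∫ ω in A, price s₀ i ω ∂(Q : Measure (Path N)) := by
      intro k hk hik
      induction k, hik using Nat.le_induction with
      | base => exact fun A _ => rfl
      | succ k hik ih =>
        intro A hA
        rw [← ih (by omega) A hA, ← sub_eq_zero,
          ← integral_sub (hpint _).integrableOn (hpint _).integrableOn]
        refine setIntegral_increment_eq_zero hw ⟨k, by omega⟩ (hdyn _) ?_
        refine (priceFiltration N s₀).mono ?_ A hA
        rw [Fin.le_def]
        exact hik
    refine (ae_eq_condExp_of_forall_setIntegral_eq ((priceFiltration N s₀).le i) (hpint j)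
      (fun A _ _ => (hpint i).integrableOn) (fun A hA _ => (hset j j.isLt hij A hA).symm)
      ?_).symm
    exact ((Filtration.stronglyAdapted_natural
      fun t => (price_measurable s₀ t).stronglyMeasurable) i).aestronglyMeasurable
  · have : IsFiniteMeasure ((Q : Measure (Path N)).map fun ω => ω i) := inferInstance
    refine ext_of_forall_integral_eq_of_IsFiniteMeasure fun f => ?_
    rw [integral_map (measurable_pi_apply i).aemeasurable
      f.continuous.measurable.aestronglyMeasurable]
    have hi := integrable_of_mem_growthSpace hw (vanilla_mem_growthSpace i f)
    have := h (0, Pi.single i f)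
    have heq : ∀ ω, gain s₀ μ (0, Pi.single i f) ω = f (ω i) - ∫ y, f y ∂(μ i : Measure ℝ) :=
      fun ω => by
        rw [gain_apply]
        have h0 : dynamicGain s₀ (0 : DynamicStrategy N) ω = 0 := by simp [dynamicGain]
        rw [h0, zero_add, staticGain, Finset.sum_eq_single i]
        · rw [Pi.single_eq_same]
        · intro j _ hj
          rw [Pi.single_eq_of_ne hj]
          simp
        · simp
    simp only [heq] at this
    rw [integral_sub hi (integrable_const _)] at this
    simp only [integral_const, probReal_univ, one_smul] at this
    linarith

end MartingaleMeasures

/-! ### Weak and strong duality -/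

section Duality

variable {N : ℕ} {s₀ : ℝ} {μ : Fin N → ProbabilityMeasure ℝ} {U : ℝ → ℝ}
  {Pfam : Set (ProbabilityMeasure (Path N))} {Ψ : Path N → ℝ} {x : ℝ}

theorem payoff_mem_growthSpace (hΨ_usc : UpperSemicontinuous Ψ)
    (hΨ_growth : ∃ c : ℝ, 0 < c ∧ ∀ ω, |Ψ ω| ≤ c * (1 + ∑ i, |ω i|)) :
    Ψ ∈ growthSpace weight :=
  ⟨hΨ_usc.measurable, hΨ_growth.imp fun _ h => h.2⟩

theorem robustValue_eq (hU : IsInadaUtility U) (hUI : UniformlyIntegrableLosses U Pfam)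
    (hΨ : Ψ ∈ growthSpace weight) :
    robustValue s₀ μ U Pfam Ψ x = ⨆ s, ⨅ P ∈ Pfam,
      ((∫ ω, U (x - Ψ ω + gain s₀ μ s ω) ∂(P : Measure (Path N)) : ℝ) : EReal) := by
  rw [robustValue, iSup_prod]
  refine iSup_congr fun H => iSup_congr fun f => iInf_congr fun P => iInf_congr fun hP => ?_
  have hX : (fun ω => x - Ψ ω) + gain s₀ μ (H, f) ∈ growthSpace weight :=
    Submodule.add_mem _ (Submodule.sub_mem _ (const_mem_growthSpace x) hΨ)
      (gain_mem_growthSpace s₀ μ _)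
  refine Eq.trans ?_ (eexp_coe (integrable_utility hU (integrable_weight hU hUI hP)
    (integrable_utility_weight hU hUI hP) hX))
  congr 1
  ext ω
  rw [gain_apply]
  congr 2
  ring

theorem dualObjective_eq (lam : ℝ) {Q : ProbabilityMeasure (Path N)}
    (hQ : Integrable weight (Q : Measure (Path N))) (hlam : 0 < lam)
    (hΨ : Ψ ∈ growthSpace weight) :
    dualObjective U Pfam Ψ x lam Q =
      robustDivergence (conj U) Pfam (ENNReal.ofReal lam • (Q : Measure (Path N))) +
        ((∫ ω, (x - Ψ ω) ∂(ENNReal.ofReal lam • (Q : Measure (Path N))) : ℝ) : EReal) := by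
  have hΨi := integrable_of_mem_growthSpace hQ hΨ
  rw [dualObjective, sub_eq_add_neg, add_assoc, ← EReal.coe_neg, ← EReal.coe_add,
    integral_smul_measure, integral_sub (integrable_const _) hΨi, ENNReal.toReal_ofReal hlam.le]
  congr 2
  simp only [integral_const, probReal_univ, smul_eq_mul]
  ring

theorem isFiniteMeasure_ofReal_smul (lam : ℝ) (Q : ProbabilityMeasure (Path N)) :
    IsFiniteMeasure (ENNReal.ofReal lam • (Q : Measure (Path N))) :=
  ⟨by simp⟩

/-- Expected utility of a semistatic strategy against a dual measure. -/
theorem integral_utility_gain_le (hU : IsInadaUtility U) (hUI : UniformlyIntegrableLosses U Pfam)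
    (hΨ : Ψ ∈ growthSpace weight) {lam : ℝ} {Q : ProbabilityMeasure (Path N)}
    (hQ : Q ∈ martingaleMeasures s₀ μ) {P : ProbabilityMeasure (Path N)} (hP : P ∈ Pfam)
    (s : DynamicStrategy N × (Fin N → (ℝ →ᵇ ℝ))) :
    ((∫ ω, U (x - Ψ ω + gain s₀ μ s ω) ∂(P : Measure (Path N)) : ℝ) : EReal) ≤
      divergence (conj U) (ENNReal.ofReal lam • (Q : Measure (Path N))) (P : Measure (Path N)) +
        ((∫ ω, (x - Ψ ω) ∂(ENNReal.ofReal lam • (Q : Measure (Path N))) : ℝ) : EReal) := by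
  rw [divergence]
  split_ifs with hac
  · have := isFiniteMeasure_ofReal_smul lam Q
    have hw := (integrable_weight_of_mem hQ).smul_measure (ENNReal.ofReal_ne_top (r := lam))
    have hX₀ : (fun ω => x - Ψ ω) ∈ growthSpace weight :=
      Submodule.sub_mem _ (const_mem_growthSpace x) hΨ
    have hX := Submodule.add_mem _ hX₀ (gain_mem_growthSpace s₀ μ s)
    have h1 := integral_utility_le hac (integrable_utility hU (integrable_weight hU hUI hP)
      (integrable_utility_weight hU hUI hP) hX) (integrable_of_mem_growthSpace hw hX)
    simp only [Pi.add_apply] at h1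
    rw [integral_add (integrable_of_mem_growthSpace hw hX₀)
      (integrable_of_mem_growthSpace hw (gain_mem_growthSpace s₀ μ s)),
      integral_smul_measure (gain s₀ μ s), integral_gain_eq_zero hQ s, smul_zero, add_zero] at h1
    exact h1
  · rw [EReal.top_add_coe]
    exact le_top

theorem robustValue_le_dualObjective (hU : IsInadaUtility U)
    (hUI : UniformlyIntegrableLosses U Pfam) (hΨ : Ψ ∈ growthSpace weight) {lam : ℝ}
    (hlam : 0 < lam) {Q : ProbabilityMeasure (Path N)} (hQ : Q ∈ martingaleMeasures s₀ μ) :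
    robustValue s₀ μ U Pfam Ψ x ≤ dualObjective U Pfam Ψ x lam Q := by
  rw [robustValue_eq hU hUI hΨ, dualObjective_eq lam (integrable_weight_of_mem hQ) hlam hΨ]
  refine iSup_le fun s => ?_
  rw [← EReal.sub_le_iff_le_add (.inl (EReal.coe_ne_bot _)) (.inl (EReal.coe_ne_top _))]
  refine le_iInf₂ fun P hP => ?_
  rw [EReal.sub_le_iff_le_add (.inl (EReal.coe_ne_bot _)) (.inl (EReal.coe_ne_top _))]
  exact (iInf₂_le P hP).trans (integral_utility_gain_le hU hUI hΨ hQ hP s)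

/-- Monotonicity transfers the tail bound from multiples of the weight. It serves both for
semicontinuity and for the finiteness of the primal value from below. -/
theorem exists_neg_utility_bound (hU : IsInadaUtility U) (hUI : UniformlyIntegrableLosses U Pfam)
    {X : Path N → ℝ} (hX : X ∈ growthSpace weight) {ε : ℝ} (hε : 0 < ε) :
    ∃ n : ℝ, 0 ≤ n ∧ ∀ P ∈ Pfam,
      ∫⁻ ω, ENNReal.ofReal (-U (X ω) - n) ∂(P : Measure (Path N)) ≤ ENNReal.ofReal ε := by
  obtain ⟨-, C, hC⟩ := hX
  obtain ⟨n, hn0, hn⟩ := exists_uniform_tail hU hUI (show 0 < |C| + 1 by positivity) hε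
  refine ⟨n, hn0, fun P hP => (lintegral_mono fun ω => ENNReal.ofReal_le_ofReal ?_).trans (hn P hP)⟩
  refine sub_le_sub_right (neg_le_neg (hU.strictMono.monotone ?_)) n
  have h1 := one_le_weight ω
  have h2 : C * weight ω ≤ (|C| + 1) * weight ω :=
    mul_le_mul_of_nonneg_right (by linarith [le_abs_self C]) (by linarith)
  linarith [(abs_le.1 (hC ω)).1]

theorem exists_affine_combination (hP_convex : IsConvexFamily Pfam)
    {P Q : ProbabilityMeasure (Path N)} (hP : P ∈ Pfam) (hQ : Q ∈ Pfam) {a b : ℝ} (ha : 0 ≤ a)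
    (hb : 0 ≤ b) (hab : a + b = 1) : ∃ R ∈ Pfam, ∀ h : Path N → ℝ,
      Integrable h (P : Measure (Path N)) → Integrable h (Q : Measure (Path N)) →
      ∫ ω, h ω ∂(R : Measure (Path N))
        = a * ∫ ω, h ω ∂(P : Measure (Path N)) + b * ∫ ω, h ω ∂(Q : Measure (Path N)) := by
  lift a to ℝ≥0 using ha
  lift b to ℝ≥0 using hb
  obtain ⟨R, hR, hRe⟩ := hP_convex ⟨P, hP, rfl⟩ ⟨Q, hQ, rfl⟩ (zero_le (a := a)) (zero_le (a := b))
    (by exact_mod_cast hab)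
  refine ⟨R, hR, fun h hhP hhQ => ?_⟩
  dsimp only at hRe
  rw [hRe, integral_add_measure (hhP.smul_measure_nnreal) (hhQ.smul_measure_nnreal),
    integral_smul_nnreal_measure, integral_smul_nnreal_measure]
  rfl

theorem exists_normalization {Ω : Type*} [MeasurableSpace Ω] {ν : Measure Ω} [IsFiniteMeasure ν]
    (hν : ν ≠ 0) : ∃ lam : ℝ, 0 < lam ∧ ∃ Q : ProbabilityMeasure Ω,
      ENNReal.ofReal lam • (Q : Measure Ω) = ν := by
  have : NeZero ν := ⟨hν⟩
  have h0 : ν univ ≠ 0 := Measure.measure_univ_ne_zero.2 hν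
  refine ⟨ν.real univ, ENNReal.toReal_pos h0 (measure_ne_top _ _), ⟨(ν univ)⁻¹ • ν, inferInstance⟩, ?_⟩
  rw [ProbabilityMeasure.coe_mk, smul_smul, Measure.real, ENNReal.ofReal_toReal (measure_ne_top _ _),
    ENNReal.mul_inv_cancel h0 (measure_ne_top _ _), one_smul]

/-- Strong duality, with an optimal dual measure. -/
theorem exists_dualObjective_le (hP_convex : IsConvexFamily Pfam) (hP_compact : IsCompact Pfam)
    (hU : IsInadaUtility U) (hUI : UniformlyIntegrableLosses U Pfam)
    (hfin : (⨅ (lam : ℝ) (_ : 0 < lam), ⨅ Q ∈ martingaleMeasures s₀ μ,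
      robustDivergence (conj U) Pfam (ENNReal.ofReal lam • (Q : Measure (Path N)))) < ⊤)
    (hΨ_usc : UpperSemicontinuous Ψ) (hΨ : Ψ ∈ growthSpace weight) :
    ∃ lam : ℝ, 0 < lam ∧ ∃ Q ∈ martingaleMeasures s₀ μ,
      dualObjective U Pfam Ψ x lam Q ≤ robustValue s₀ μ U Pfam Ψ x := by
  simp only [iInf_lt_iff] at hfin
  obtain ⟨lam₀, hlam₀, Q₀, hQ₀, hfin⟩ := hfin
  have hfin' := hfin
  simp only [robustDivergence, iInf_lt_iff] at hfin'
  obtain ⟨P₀, hP₀, hdiv⟩ := hfin'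
  have hX₀ : (fun ω => x - Ψ ω) ∈ growthSpace weight :=
    Submodule.sub_mem _ (const_mem_growthSpace x) hΨ
  have hX := fun s => Submodule.add_mem _ hX₀ (gain_mem_growthSpace s₀ μ s)
  have hint : ∀ P ∈ Pfam, ∀ X ∈ growthSpace weight,
      Integrable (fun ω => U (X ω)) (P : Measure (Path N)) := fun P hP X hX =>
    integrable_utility hU (integrable_weight hU hUI hP) (integrable_utility_weight hU hUI hP) hX
  set F : ProbabilityMeasure (Path N) → DynamicStrategy N × (Fin N → (ℝ →ᵇ ℝ)) → ℝ :=
    fun P s => ∫ ω, U (x - Ψ ω + gain s₀ μ s ω) ∂(P : Measure (Path N)) with hF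
  have hR : robustValue s₀ μ U Pfam Ψ x = ⨆ s, ⨅ P ∈ Pfam, ((F P s : ℝ) : EReal) :=
    robustValue_eq hU hUI hΨ
  -- Finite above by weak duality at `(lam₀, Q₀)`, below by the zero strategy.
  obtain ⟨u, hu⟩ : ∃ u : ℝ, robustValue s₀ μ U Pfam Ψ x = u := by
    refine ⟨_, (EReal.coe_toReal ?_ ?_).symm⟩
    · refine ne_top_of_le_ne_top ?_ (robustValue_le_dualObjective hU hUI hΨ hlam₀ hQ₀)
      rw [dualObjective_eq lam₀ (integrable_weight_of_mem hQ₀) hlam₀ hΨ]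
      exact (EReal.add_lt_top hfin.ne (EReal.coe_ne_top _)).ne
    · obtain ⟨n, -, hn⟩ := exists_neg_utility_bound hU hUI (hX 0) one_pos
      refine ne_bot_of_le_ne_bot (EReal.coe_ne_bot (-n - 1)) ?_
      rw [hR]
      refine le_iSup_of_le 0 (le_iInf₂ fun P hP => EReal.coe_le_coe_iff.2 ?_)
      have hi : Integrable (fun ω => U (x - Ψ ω + gain s₀ μ 0 ω)) (P : Measure (Path N)) :=
        hint P hP _ (hX 0)
      have h1 : Integrable (fun ω => U (x - Ψ ω + gain s₀ μ 0 ω) + n) (P : Measure (Path N)) :=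
        hi.add (integrable_const n)
      have h2 := integral_eq_lintegral_pos_part_sub_lintegral_neg_part h1
      have h3 := ENNReal.toReal_le_of_le_ofReal zero_le_one (hn P hP)
      rw [integral_add hi (integrable_const n)] at h2
      simp only [integral_const, probReal_univ, one_smul, neg_add', Pi.add_apply] at h2 h3
      have h4 := ENNReal.toReal_nonneg (a := ∫⁻ ω, ENNReal.ofReal (U (x - Ψ ω + gain s₀ μ 0 ω) + n)
        ∂(P : Measure (Path N)))
      simp only [hF]
      linarith
  rw [hu] at hR
  have hle : ∀ s, ∀ v : ℝ, u < v → ∃ P ∈ Pfam, F P s < v := fun s v hv => by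
    have h1 : ⨅ P ∈ Pfam, ((F P s : ℝ) : EReal) < v :=
      ((le_iSup (fun s => ⨅ P ∈ Pfam, ((F P s : ℝ) : EReal)) s).trans hR.ge).trans_lt
        (EReal.coe_lt_coe_iff.2 hv)
    simp only [iInf_lt_iff] at h1
    obtain ⟨P, hP, hPv⟩ := h1
    exact ⟨P, hP, EReal.coe_lt_coe_iff.1 hPv⟩
  obtain ⟨P, hP, hPu⟩ := exists_forall_le_of_concave hP_compact F
    (fun s => lowerSemicontinuousOn_integral
      (hU.differentiable.continuous.comp_lowerSemicontinuous
        (((continuous_const.sub continuous_id).comp_upperSemicontinuous_antitone hΨ_usc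
          fun a b hab => sub_le_sub_left hab x).add (continuous_gain s₀ μ s).lowerSemicontinuous)
        hU.strictMono.monotone)
      (fun P hP => hint P hP _ (hX s))
      fun ε hε => (exists_neg_utility_bound hU hUI (hX s) hε).imp fun _ h => h.2)
    (fun P hP Q hQ a b ha hb hab => by
      obtain ⟨R, hR, h⟩ := exists_affine_combination hP_convex hP hQ ha hb hab
      exact ⟨R, hR, fun s => h _ (hint P hP _ (hX s)) (hint Q hQ _ (hX s))⟩)
    (fun P hP => ⟨convex_univ, fun s _ s' _ a b ha hb hab => by
      have := concave_expected_utility hU (integrable_weight hU hUI hP)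
        (integrable_utility_weight hU hUI hP) (hX s) (hX s') ha hb hab
      refine this.trans_eq (integral_congr_ae (.of_forall fun ω => ?_))
      simp only [map_add, map_smul, Pi.add_apply, Pi.smul_apply, smul_eq_mul]
      congr 1
      -- Wealth is only affine in the strategy, so `x - Ψ` is recovered from `a + b = 1`.
      have hb' : b = 1 - a := by linarith
      rw [hb']
      ring⟩)
    u (fun s ε hε => hle s _ (by linarith))
  obtain ⟨ν, hνfin, hνP, hνw, hνG, hν⟩ := exists_dual_measure hU continuous_weight.measurable
    one_le_weight (integrable_weight hU hUI hP) (integrable_utility_weight hU hUI hP)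
    (LinearMap.range (gain s₀ μ)) (by rintro _ ⟨s, rfl⟩; exact gain_mem_growthSpace s₀ μ s) hX₀
    (u := u) (by rintro _ ⟨s, rfl⟩; exact hPu s)
  -- If `ν = 0`, the majorant at constants gives `U ≤ u`; then under `P₀` every strategy stays below
  -- some `v < u`, although the value is `u`.
  have hν0 : ν ≠ 0 := by
    rintro rfl
    have hUu : ∀ y, U y ≤ u := fun y => by simpa using hν _ (const_mem_growthSpace y)
    rw [divergence] at hdiv
    split_ifs at hdiv with hac
    · have := isFiniteMeasure_ofReal_smul lam₀ Q₀
      have hne : ENNReal.ofReal lam₀ • (Q₀ : Measure (Path N)) ≠ 0 := fun h => by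
        have := congrArg (fun m => m univ) h
        simp [hlam₀.not_ge] at this
      obtain ⟨v, hvu, hv⟩ := exists_lt_integral_utility_le hU hUu hac hne hdiv.ne
        (∫ ω, (x - Ψ ω) ∂(ENNReal.ofReal lam₀ • (Q₀ : Measure (Path N))))
      have hw := (integrable_weight_of_mem hQ₀).smul_measure (ENNReal.ofReal_ne_top (r := lam₀))
      refine (EReal.coe_lt_coe_iff.2 hvu).not_ge ?_
      rw [hR]
      refine iSup_le fun s => (iInf₂_le P₀ hP₀).trans (EReal.coe_le_coe_iff.2 ?_)
      refine hv _ (hint P₀ hP₀ _ (hX s)) (integrable_of_mem_growthSpace hw (hX s)) ?_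
      rw [integral_add (integrable_of_mem_growthSpace hw hX₀)
        (integrable_of_mem_growthSpace hw (gain_mem_growthSpace s₀ μ s)),
        integral_smul_measure (gain s₀ μ s), integral_gain_eq_zero hQ₀ s, smul_zero, add_zero]
    · exact lt_irrefl _ hdiv
  obtain ⟨lam, hlam, Q, rfl⟩ := exists_normalization hν0
  have hlamt := ENNReal.ofReal_pos.2 hlam
  have hQw : Integrable weight (Q : Measure (Path N)) :=
    (integrable_smul_measure hlamt.ne' ENNReal.ofReal_ne_top).1 hνw
  have hQ : Q ∈ martingaleMeasures s₀ μ := by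
    refine mem_martingaleMeasures_of_integral_gain hQw fun s => ?_
    have := hνG _ ⟨s, rfl⟩
    rw [integral_smul_measure, ENNReal.toReal_ofReal hlam.le, smul_eq_mul] at this
    exact (mul_eq_zero.1 this).resolve_left hlam.ne'
  refine ⟨lam, hlam, Q, hQ, ?_⟩
  rw [hu, dualObjective_eq lam hQw hlam hΨ]
  -- The majorant, restricted to bounded `X`, is exactly the bound on `E_P[U(X)] - ∫ X dν` required
  -- here.
  have hJ := eexp_conj_le hU hνP
    (c := u - ∫ ω, (x - Ψ ω) ∂(ENNReal.ofReal lam • (Q : Measure (Path N))))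
    fun X hXm ⟨C, hC⟩ => by
      have := hν X (growthSpace_of_bounded one_le_weight hXm hC)
      linarith
  calc _ ≤ divergence (conj U) (ENNReal.ofReal lam • (Q : Measure (Path N))) P +
        ((∫ ω, (x - Ψ ω) ∂(ENNReal.ofReal lam • (Q : Measure (Path N))) : ℝ) : EReal) := by
        gcongr
        exact iInf₂_le P hP
    _ ≤ ((u - ∫ ω, (x - Ψ ω) ∂(ENNReal.ofReal lam • (Q : Measure (Path N))) : ℝ) : EReal) +
        ((∫ ω, (x - Ψ ω) ∂(ENNReal.ofReal lam • (Q : Measure (Path N))) : ℝ) : EReal) := by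
        rw [divergence, if_pos hνP]
        gcongr
    _ = u := by rw [← EReal.coe_add, sub_add_cancel]

end Duality

end Semistatic

theorem mainTheorem2 (N : ℕ) (hN : 1 ≤ N) (s₀ : ℝ)
    (Pfam : Set (ProbabilityMeasure (Semistatic.Path N)))
    (hP_convex : Semistatic.IsConvexFamily Pfam) (hP_compact : IsCompact Pfam)
    (μ : Fin N → ProbabilityMeasure ℝ) (hμ : Semistatic.IncreasingConvexOrder s₀ μ)
    (U : ℝ → ℝ) (hU : Semistatic.IsInadaUtility U)
    (hfin : (⨅ (lam : ℝ) (_ : 0 < lam), ⨅ Q ∈ Semistatic.martingaleMeasures s₀ μ,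
      Semistatic.robustDivergence (Semistatic.conj U) Pfam
        (ENNReal.ofReal lam • (Q : Measure (Semistatic.Path N)))) < ⊤)
    (hUI : Semistatic.UniformlyIntegrableLosses U Pfam)
    (Ψ : Semistatic.Path N → ℝ) (hΨ_usc : UpperSemicontinuous Ψ)
    (hΨ_growth : ∃ c : ℝ, 0 < c ∧ ∀ ω, |Ψ ω| ≤ c * (1 + ∑ i, |ω i|))
    (x : ℝ) :
    (∀ Q ∈ Semistatic.martingaleMeasures s₀ μ,
      Integrable Ψ (Q : Measure (Semistatic.Path N))) ∧
    IsLeast {z : EReal | ∃ lam : ℝ, 0 < lam ∧ ∃ Q ∈ Semistatic.martingaleMeasures s₀ μ,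
        z = Semistatic.dualObjective U Pfam Ψ x lam Q}
      (Semistatic.robustValue s₀ μ U Pfam Ψ x) := by
  have hΨ := Semistatic.payoff_mem_growthSpace hΨ_usc hΨ_growth
  refine ⟨fun Q hQ => Semistatic.integrable_of_mem_growthSpace
    (Semistatic.integrable_weight_of_mem hQ) hΨ, ?_, ?_⟩
  · obtain ⟨lam, hlam, Q, hQ, hle⟩ := Semistatic.exists_dualObjective_le (x := x) hP_convex
      hP_compact hU hUI hfin hΨ_usc hΨ
    exact ⟨lam, hlam, Q, hQ,
      le_antisymm (Semistatic.robustValue_le_dualObjective hU hUI hΨ hlam hQ) hle⟩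
  · rintro _ ⟨lam, hlam, Q, hQ, rfl⟩
    exact Semistatic.robustValue_le_dualObjective hU hUI hΨ hlam hQ
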